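/- Let $a,b,c,d\ge 0$ be integers with $S:=a+b=c+d$ and $bc\neq 0$, put $m:=a-c=d-b$ and $\sigma:=m/S$, and assume $\sigma>\tfrac12$ (so $\tfrac S2<m<S$). Consider the two-colour P\'olya urn in discrete time: at each step a ball is drawn uniformly at random from the urn and put back; if it is red, $a$ red and $b$ black balls are added, and if it is black, $c$ red and $d$ black balls are added. Let $U_{(\alpha,\beta)}(n)\in\mathbb N^2$ be the composition (red, black) of the urn after $n$ draws when it starts with $\alpha$ red and $\beta$ black balls, and let $u_2(x,y)=\frac1S(bx-cy)$. Then the limits $$X=W^{DT}_{(1,0)}:=\lim_{n\to\infty}\frac{u_2\big(U_{(1,0)}(n)\big)}{n^{\sigma}},\qquad Y=W^{DT}_{(0,1)}:=\lim_{n\to\infty}\frac{u_2\big(U_{(0,1)}(n)\big)}{n^{\sigma}}$$ exist almost surely and, writing $\varphi_X(t)=\mathbb E(e^{itX})$ and $\varphi_Y(t)=\mathbb E(e^{itY})$: (i) the supports of (the laws of) $X$ and $Y$ are both equal to $\mathbb R$; (ii) for every $\rho\in\left]0,\frac{a+1}{m}\right[$ there is $C>0$ such that $|\varphi_X(t)|\le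 C|t|^{-\rho}$ for all $t\in\mathbb R\setminus\{0\}$; (iii) for every $\rho\in\left]0,\frac{d+1}{m}\right[$ there is $C>0$ such that $|\varphi_Y(t)|\le C|t|^{-\rho}$ for all $t\in\mathbb R\setminus\{0\}$; (iv) the laws of $X$ and $Y$ are absolutely continuous with respect to Lebesgue measure, with densities that are bounded and continuous on $\mathbb R$. -/

import Mathlib

open MeasureTheory ProbabilityTheory Filter Topology

namespace PolyaUrn

/-- One-step transition probability of the two-colour urn with replacement matrix
`(a, b; c, d)`: from the composition `x = (red, black)`, a ball is drawn uniformly among the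
`x.1 + x.2` balls of the urn; if it is red, `a` red and `b` black balls are added, and if it is
black, `c` red and `d` black balls are added. -/
noncomputable def stepProb (a b c d : ℕ) (x y : ℕ × ℕ) : ENNReal :=
  (if y = (x.1 + a, x.2 + b) then (x.1 : ENNReal) / ((x.1 + x.2 : ℕ) : ENNReal) else 0) +
  (if y = (x.1 + c, x.2 + d) then (x.2 : ENNReal) / ((x.1 + x.2 : ℕ) : ENNReal) else 0)

/-- `U` is a discrete-time two-colour Pólya urn process with replacement matrix `(a, b; c, d)`,
started from the composition `init`, on the probability space `(Ω, P)`: it is the Markov chain on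
`ℕ × ℕ` started at `init` with transition probabilities `stepProb a b c d`. -/
structure IsUrnProcess (a b c d : ℕ) (init : ℕ × ℕ) {Ω : Type*} [MeasurableSpace Ω]
    (P : Measure Ω) (U : ℕ → Ω → ℕ × ℕ) : Prop where
  measurable : ∀ n, Measurable (U n)
  start : ∀ᵐ ω ∂P, U 0 ω = init
  step : ∀ (n : ℕ) (x : ℕ → ℕ × ℕ),
    P {ω | ∀ i ≤ n + 1, U i ω = x i} =
      P {ω | ∀ i ≤ n, U i ω = x i} * stepProb a b c d (x n) (x (n + 1))

/-- The eigenvalue `m = a - c` (it equals `d - b` when `a + b = c + d`). -/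
def eigm (a c : ℕ) : ℝ := (a : ℝ) - (c : ℝ)

/-- The ratio `σ = m / S` of the eigenvalues, with `S = a + b`. -/
noncomputable def sigma (a b c : ℕ) : ℝ := eigm a c / ((a : ℝ) + (b : ℝ))

/-- The eigenform `u₂(x, y) = (b x - c y) / S` of the transposed replacement matrix. -/
noncomputable def u₂ (a b c : ℕ) (x : ℕ × ℕ) : ℝ :=
  ((b : ℝ) * (x.1 : ℝ) - (c : ℝ) * (x.2 : ℝ)) / ((a : ℝ) + (b : ℝ))

/-- The normalised second projection `u₂(U(n)) / n ^ σ` of the urn process. -/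
noncomputable def normProj (a b c : ℕ) {Ω : Type*} (U : ℕ → Ω → ℕ × ℕ) (n : ℕ) (ω : Ω) : ℝ :=
  u₂ a b c (U n ω) / (n : ℝ) ^ sigma a b c

/-- The limit random variable `W = lim u₂(U(n)) / n ^ σ` of the urn process (an arbitrary value is
taken where the limit does not exist). -/
noncomputable def W (a b c : ℕ) {Ω : Type*} (U : ℕ → Ω → ℕ × ℕ) (ω : Ω) : ℝ :=
  limUnder atTop (fun n : ℕ => normProj a b c U n ω)

/-- The real probability measure `ν` is absolutely continuous with respect to Lebesgue measure,
with a bounded continuous density. -/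
def HasBoundedContinuousDensity (ν : Measure ℝ) : Prop :=
  ν ≪ volume ∧
    ∃ f : ℝ → ℝ, Continuous f ∧ (∀ x, 0 ≤ f x) ∧ (∃ M : ℝ, ∀ x, f x ≤ M) ∧
      ν = volume.withDensity (fun x => ENNReal.ofReal (f x))

section Existence

open Finset

/-- The one-step transition law of the urn as a measure (the empty urn stays empty). -/
noncomputable def stepMeasure (a b c d : ℕ) (x : ℕ × ℕ) : Measure (ℕ × ℕ) :=
  if x.1 + x.2 = 0 then Measure.dirac x else
    ((x.1 : ENNReal) / ((x.1 + x.2 : ℕ) : ENNReal)) • Measure.dirac (x.1 + a, x.2 + b) +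
    ((x.2 : ENNReal) / ((x.1 + x.2 : ℕ) : ENNReal)) • Measure.dirac (x.1 + c, x.2 + d)

instance isProbabilityMeasure_stepMeasure (a b c d : ℕ) (x : ℕ × ℕ) : IsProbabilityMeasure (stepMeasure a b c d x) := by
  unfold stepMeasure
  split_ifs with h
  · infer_instance
  · constructor
    simp only [Measure.add_apply, Measure.smul_apply, measure_univ, smul_eq_mul, mul_one]
    rw [← ENNReal.add_div, ← Nat.cast_add]
    exact ENNReal.div_self (by exact_mod_cast h) (ENNReal.natCast_ne_top _)

/-- Urn processes exist: for every nonempty initial composition there is one on path space. -/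
theorem exists_isUrnProcess (a b c d : ℕ) (init : ℕ × ℕ) (h : init ≠ (0, 0)) :
    ∃ P : Measure (ℕ → ℕ × ℕ), IsProbabilityMeasure P ∧
      IsUrnProcess a b c d init P (fun n ω => ω n) := by
  let κ : (n : ℕ) → Kernel (Π _ : Iic n, ℕ × ℕ) (ℕ × ℕ) := fun n =>
    Kernel.comap ⟨stepMeasure a b c d, measurable_of_countable _⟩
      (fun y : (Π _ : Iic n, ℕ × ℕ) => y ⟨n, by simp⟩) (by fun_prop)
  have hκ : ∀ n, IsMarkovKernel (κ n) := fun n =>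
    ⟨fun y => inferInstanceAs (IsProbabilityMeasure (stepMeasure a b c d _))⟩
  let P : Measure (ℕ → ℕ × ℕ) := Kernel.traj (X := fun _ => ℕ × ℕ) κ 0 (fun _ => init)
  have key (n : ℕ) (x : ℕ → ℕ × ℕ) : P {ω | ∀ i ≤ n + 1, ω i = x i} =
      P {ω | ∀ i ≤ n, ω i = x i} * stepMeasure a b c d (x n) {x (n + 1)} := by
    have e := Kernel.partialTraj_compProd_eq_map_traj
      (X := fun _ => ℕ × ℕ) (κ := κ) (Nat.zero_le n) (x₀ := fun _ => init)
    rw [← Kernel.traj_map_frestrictLe_apply] at e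
    let r : Π _ : Iic n, ℕ × ℕ := fun i => x i
    have e2 := congrArg (fun ν => ν ({r} ×ˢ {x (n + 1)})) e
    rw [Measure.compProd_apply_prod (.singleton _) (.singleton _), lintegral_singleton,
      Measure.map_apply (by fun_prop) ((MeasurableSet.singleton _).prod (.singleton _)),
      Measure.map_apply (by fun_prop) (.singleton _)] at e2
    have s1 : {ω : ℕ → ℕ × ℕ | ∀ i ≤ n + 1, ω i = x i} =
        (fun x ↦ (Preorder.frestrictLe (π := fun _ => ℕ × ℕ) n x, x (n + 1))) ⁻¹'
          ({r} ×ˢ {x (n + 1)}) := by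
      ext ω
      simp only [Set.mem_ofPred_eq, Set.mem_preimage, Set.mem_prod, Set.mem_singleton_iff,
        funext_iff, Subtype.forall, mem_Iic]
      constructor
      · exact fun h => ⟨fun i hi => h i (by omega), h _ le_rfl⟩
      · rintro ⟨h1, h2⟩ i hi
        rcases Nat.lt_or_ge n i with h | h
        · obtain rfl : i = n + 1 := by omega
          exact h2
        · exact h1 i h
    have s2 : {ω : ℕ → ℕ × ℕ | ∀ i ≤ n, ω i = x i} =
        (Preorder.frestrictLe (π := fun _ => ℕ × ℕ) n) ⁻¹' {r} := by
      ext ω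
      simp only [Set.mem_ofPred_eq, Set.mem_preimage, Set.mem_singleton_iff,
        funext_iff, Subtype.forall, mem_Iic]
      rfl
    rw [s1, s2, ← e2, mul_comm]
    rfl
  have h0 : ∀ᵐ ω ∂P, ω 0 = init := by
    have hm : P.map (Preorder.frestrictLe (π := fun _ => ℕ × ℕ) 0) =
        Measure.dirac (fun _ => init) := by
      rw [Kernel.traj_map_frestrictLe_apply, Kernel.partialTraj_self, Kernel.id_apply]
    have h1 : ∀ᵐ y ∂(P.map (Preorder.frestrictLe (π := fun _ => ℕ × ℕ) 0)),
        y ⟨0, by simp⟩ = init := by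
      rw [hm]
      have hs : MeasurableSet {y : (Π _ : Iic 0, ℕ × ℕ) | y ⟨0, by simp⟩ = init} :=
        (Set.to_countable _).measurableSet
      exact (ae_dirac_iff hs).2 rfl
    exact ae_of_ae_map (by fun_prop) h1
  have hpos : ∀ n (x : ℕ → ℕ × ℕ), (x n).1 + (x n).2 = 0 → P {ω | ∀ i ≤ n, ω i = x i} = 0 := by
    intro n
    induction n with
    | zero =>
      intro x hx
      refine measure_mono_null (t := {ω | ¬ ω 0 = init}) (fun ω hω => ?_) (ae_iff.1 h0)
      have e : ω 0 = x 0 := hω 0 le_rfl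
      intro (e' : ω 0 = init)
      refine h ?_
      rw [← e', e]
      ext
      · show (x 0).1 = 0
        omega
      · show (x 0).2 = 0
        omega
    | succ n ih =>
      intro x hx
      rw [key]
      by_cases hn : (x n).1 + (x n).2 = 0
      · rw [ih x hn, zero_mul]
      · have h1 : ((x n).1 + a, (x n).2 + b) ≠ x (n + 1) := fun e => by
          rw [← e] at hx; simp only at hx; omega
        have h2 : ((x n).1 + c, (x n).2 + d) ≠ x (n + 1) := fun e => by
          rw [← e] at hx; simp only at hx; omega
        rw [stepMeasure, if_neg hn]
        simp [h1, h2]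
  refine ⟨P, inferInstance, fun n => by fun_prop, h0, fun n x => ?_⟩
  rw [key]
  by_cases hx : (x n).1 + (x n).2 = 0
  · rw [hpos n x hx]; simp
  · congr 1
    unfold stepMeasure stepProb
    rw [if_neg hx]
    simp [Set.indicator_apply, eq_comm]

end Existence

end PolyaUrn

/-! Existence of the limits. The form `u₂` is an eigenform of the mean replacement, so `u₂(U(n))`
divided by the deterministic product `growth` is a martingale. This product is of order `n ^ σ`, and
`σ > 1/2` makes the sum of `growth⁻²` finite. The martingale is then bounded in L², hence converges
almost surely and in mean (`IsUrnProcess.exists_limit`), and the mean of the limit is a positive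
multiple of `u₂` of the initial composition. The characteristic functions at time `n` are iterates
of the transition operator, so the limit law depends only on the initial composition; it is called
`law`.

Fixed-point equations. On multiplicative functions of the composition the unnormalised transition
operator obeys a Leibniz rule. Balance turns the normalising constants into rising factorials, which
are beta moments. In the limit (`IsLarge.law_add`) the law started from `x + y` is that of `V ^ σ X
+ (1 - V) ^ σ Y`, where `X`, `Y`, `V` are independent, `X` and `Y` have the laws started from `x`
and `y`, and `V` is beta with parameters the numbers of balls of `x` and `y` over `S`. From a single
ball the first draw is forced, so `law (1,0) = law (a+1,b)` and `law (0,1) = law (c,d+1)`: the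
one-ball laws satisfy a closed system.

Supports. The one-ball support is stable under `(p, q) ↦ v ^ σ p + (1 - v) ^ σ q`. It contains both
signs, since the means have both signs and the two colours have equal supports. It is an interval by
the intermediate value theorem, and it is unbounded both ways because `v = 1/2` dilates by `2 ^ (1 -
σ) > 1`.

Decay. Full support gives modulus less than one away from `0`. A first-bad-time argument on the
mixture gives a uniform bound `q < 1` on `[1, ∞)`; then the limit superior `L` satisfies `L ≤ qL`,
so the modulus vanishes at infinity. A weighted supremum argument upgrades this to the rate `t ^
(-ρ)` for every `ρ < 1/m`, the condition `σρ < 1/S` being integrability of `v ^ (-σρ)` under the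
beta law. Rates add over balls, so the `a + 1` red balls of `(a+1, b)` give every `ρ < (a+1)/m`, and
likewise for black. Since these thresholds exceed one, the characteristic functions are integrable
and Fourier inversion yields the densities. -/

namespace PolyaUrn

/-! ### The one-step operator -/

section Step

variable {E : Type*} [NormedAddCommGroup E]

variable [NormedSpace ℝ E]

/-- The transition operator of the urn, acting on functions of the composition. -/
noncomputable def transition (a b c d : ℕ) (g : ℕ × ℕ → E) (x : ℕ × ℕ) : E :=
  ∫ y, g y ∂stepMeasure a b c d x

lemma transition_apply [CompleteSpace E] (a b c d : ℕ) (g : ℕ × ℕ → E) {x : ℕ × ℕ}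
    (hx : x ≠ 0) : transition a b c d g x =
      ((x.1 : ℝ) / (x.1 + x.2)) • g (x.1 + a, x.2 + b) +
      ((x.2 : ℝ) / (x.1 + x.2)) • g (x.1 + c, x.2 + d) := by
  have hx' : x.1 + x.2 ≠ 0 := fun h => hx (by ext <;> simp <;> omega)
  have hfin (k : ℕ) : (k : ENNReal) / ((x.1 + x.2 : ℕ) : ENNReal) ≠ ⊤ :=
    ENNReal.div_ne_top (by simp) (by exact_mod_cast hx')
  unfold transition stepMeasure
  rw [if_neg hx', integral_add_measure, integral_smul_measure, integral_smul_measure,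
    integral_dirac, integral_dirac]
  · simp [ENNReal.toReal_add]
  all_goals exact (integrable_dirac (by simp)).smul_measure (hfin _)

lemma norm_transition_le (a b c d : ℕ) {g : ℕ × ℕ → E} {C : ℝ} (hg : ∀ x, ‖g x‖ ≤ C)
    (x : ℕ × ℕ) : ‖transition a b c d g x‖ ≤ C := by
  have := norm_integral_le_of_norm_le_const (μ := stepMeasure a b c d x) (f := g) (C := C)
    (ae_of_all _ hg)
  simpa [transition] using this

/-- `stepMeasure` as a Markov kernel reading the last entry of a finite path. -/
noncomputable def stepKernel (a b c d n : ℕ) :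
    Kernel (Π _ : Finset.Iic n, ℕ × ℕ) (ℕ × ℕ) :=
  Kernel.comap ⟨stepMeasure a b c d, measurable_of_countable _⟩
    (fun y : (Π _ : Finset.Iic n, ℕ × ℕ) => y ⟨n, by simp⟩) (by fun_prop)

instance (a b c d n : ℕ) : IsMarkovKernel (stepKernel a b c d n) :=
  ⟨fun _ => inferInstanceAs (IsProbabilityMeasure (stepMeasure a b c d _))⟩

lemma stepKernel_apply (a b c d n : ℕ) (y : Π _ : Finset.Iic n, ℕ × ℕ) :
    stepKernel a b c d n y = stepMeasure a b c d (y ⟨n, by simp⟩) := rfl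

end Step

/-! ### The urn process as a Markov chain -/

section MarkovChain

variable {a b c d : ℕ} {init : ℕ × ℕ} {Ω : Type*} [MeasurableSpace Ω] {P : Measure Ω}
  {U : ℕ → Ω → ℕ × ℕ}

/-- The path of a process up to time `n`. -/
def pathUpTo (U : ℕ → Ω → ℕ × ℕ) (n : ℕ) (ω : Ω) : Π _ : Finset.Iic n, ℕ × ℕ := fun i => U i ω

lemma IsUrnProcess.measurable_pathUpTo (hU : IsUrnProcess a b c d init P U) (n : ℕ) :
    Measurable (pathUpTo U n) :=
  measurable_pi_lambda _ fun i => hU.measurable i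

/-- The filtration generated by an urn process. -/
def IsUrnProcess.filtration (hU : IsUrnProcess a b c d init P U) :
    Filtration ℕ (inferInstance : MeasurableSpace Ω) where
  seq n := MeasurableSpace.comap (pathUpTo U n) inferInstance
  mono' := by
    intro m n hmn
    have : pathUpTo U m = (fun y (i : Finset.Iic m) =>
      y ⟨i, Finset.mem_Iic.2 ((Finset.mem_Iic.1 i.2).trans hmn)⟩) ∘ pathUpTo U n := rfl
    simp only
    rw [this, ← MeasurableSpace.comap_comp]
    exact MeasurableSpace.comap_mono (Measurable.comap_le (by fun_prop))
  le' n := (hU.measurable_pathUpTo n).comap_le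

lemma IsUrnProcess.measurable_filtration (hU : IsUrnProcess a b c d init P U) (n : ℕ) :
    Measurable[hU.filtration n] (U n) := by
  have : U n = (fun y : Π _ : Finset.Iic n, ℕ × ℕ => y ⟨n, by simp⟩) ∘ pathUpTo U n := rfl
  rw [this]
  exact Measurable.comp (by fun_prop) (Measurable.of_comap_le le_rfl)

lemma stepMeasure_singleton (a b c d : ℕ) {x : ℕ × ℕ} (hx : x ≠ 0) (y : ℕ × ℕ) :
    stepMeasure a b c d x {y} = stepProb a b c d x y := by
  have hx' : x.1 + x.2 ≠ 0 := fun h => hx (by ext <;> simp <;> omega)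
  unfold stepMeasure stepProb
  rw [if_neg hx']
  simp [Set.indicator_apply, eq_comm]

/-- Coordinates never decrease, so the urn cannot become empty. The point matters because `stepProb`
vanishes at the empty urn while `stepMeasure` is a Dirac mass there. -/
lemma IsUrnProcess.cylinder_eq_zero (hU : IsUrnProcess a b c d init P U) (h : init ≠ 0) (n : ℕ)
    (x : ℕ → ℕ × ℕ) (hx : x n = 0) : P {ω | ∀ i ≤ n, U i ω = x i} = 0 := by
  induction n generalizing x with
  | zero =>
    refine measure_mono_null (t := {ω | ¬ U 0 ω = init}) (fun ω hω => ?_) (ae_iff.1 hU.start)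
    have e : U 0 ω = x 0 := hω 0 le_rfl
    intro (e' : U 0 ω = init)
    exact h (by rw [← e', e, hx])
  | succ n ih =>
    rw [hU.step]
    by_cases hn : x n = 0
    · rw [ih x hn, zero_mul]
    · rw [hx]
      have hn' : (x n).1 ≠ 0 ∨ (x n).2 ≠ 0 := by
        by_contra! hh
        exact hn (by ext <;> simp [hh])
      have h1 : (0 : ℕ × ℕ) ≠ ((x n).1 + a, (x n).2 + b) := fun e => by
        simp only [Prod.ext_iff, Prod.fst_zero, Prod.snd_zero] at e; omega
      have h2 : (0 : ℕ × ℕ) ≠ ((x n).1 + c, (x n).2 + d) := fun e => by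
        simp only [Prod.ext_iff, Prod.fst_zero, Prod.snd_zero] at e; omega
      simp [stepProb, h1, h2]

variable [IsProbabilityMeasure P]

/-- The Markov property in joint form. Finite paths form a countable space, so the cylinder
identities of `IsUrnProcess.step` determine the measure. -/
lemma IsUrnProcess.map_pathUpTo_prod (hU : IsUrnProcess a b c d init P U) (h : init ≠ 0) (n : ℕ) :
    P.map (fun ω => (pathUpTo U n ω, U (n + 1) ω)) =
      P.map (pathUpTo U n) ⊗ₘ stepKernel a b c d n := by
  refine Measure.ext_of_singleton fun ⟨z, y⟩ => ?_
  rw [← Set.singleton_prod_singleton,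
    Measure.compProd_apply_prod (.singleton _) (.singleton _), lintegral_singleton,
    Measure.map_apply ((hU.measurable_pathUpTo n).prodMk (hU.measurable _))
      ((MeasurableSet.singleton _).prod (.singleton _)),
    Measure.map_apply (hU.measurable_pathUpTo n) (.singleton _), stepKernel_apply]
  -- The finite path `z` is continued by `y` because `step` speaks of infinite sequences.
  let x : ℕ → ℕ × ℕ := fun i => if hi : i ≤ n then z ⟨i, by simpa using hi⟩ else y
  have s2 : pathUpTo U n ⁻¹' {z} = {ω | ∀ i ≤ n, U i ω = x i} := by
    ext ω
    simp only [Set.mem_preimage, Set.mem_singleton_iff, funext_iff, Set.mem_ofPred_eq,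
      Subtype.forall, Finset.mem_Iic, pathUpTo]
    exact forall₂_congr fun i hi => by simp [x, hi]
  have s1 : (fun ω => (pathUpTo U n ω, U (n + 1) ω)) ⁻¹' ({z} ×ˢ {y}) =
      {ω | ∀ i ≤ n + 1, U i ω = x i} := by
    ext ω
    have := Set.ext_iff.1 s2 ω
    simp only [Set.mem_preimage, Set.mem_singleton_iff, Set.mem_ofPred_eq, Set.mem_prod] at this ⊢
    rw [this]
    have hy : x (n + 1) = y := by simp [x]
    constructor
    · rintro ⟨h1, h2⟩ i hi
      rcases Nat.lt_or_ge n i with h' | h'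
      · obtain rfl : i = n + 1 := by omega
        rw [h2, hy]
      · exact h1 i h'
    · exact fun h' => ⟨fun i hi => h' i (by omega), by rw [h' _ le_rfl, hy]⟩
  have hxn : x n = z ⟨n, by simp⟩ := by simp [x]
  have hy : x (n + 1) = y := by simp [x]
  rw [s1, s2, hU.step, ← hxn, hy, mul_comm]
  by_cases hx : x n = 0
  · rw [hU.cylinder_eq_zero h n x hx]; simp
  · rw [stepMeasure_singleton _ _ _ _ hx]

lemma IsUrnProcess.condExp_eq (hU : IsUrnProcess a b c d init P U) (h : init ≠ 0) (n : ℕ)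
    {E : Type*} [NormedAddCommGroup E] [NormedSpace ℝ E] [CompleteSpace E] (g : ℕ × ℕ → E)
    (hg : StronglyMeasurable g) (hint : Integrable (fun ω => g (U (n + 1) ω)) P) :
    P[fun ω => g (U (n + 1) ω) | hU.filtration n] =ᵐ[P]
      fun ω => transition a b c d g (U n ω) := by
  refine (condExp_ae_eq_integral_condDistrib (hU.measurable_pathUpTo n)
    (hU.measurable (n + 1)).aemeasurable hg hint).trans ?_
  have := condDistrib_ae_eq_of_measure_eq_compProd (pathUpTo U n)
    (hU.measurable (n + 1)).aemeasurable (hU.map_pathUpTo_prod h n)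
  filter_upwards [ae_of_ae_map (hU.measurable_pathUpTo n).aemeasurable this] with ω hω
  rw [hω]
  rfl

lemma IsUrnProcess.integral_succ (hU : IsUrnProcess a b c d init P U) (h : init ≠ 0) (n : ℕ)
    {E : Type*} [NormedAddCommGroup E] [NormedSpace ℝ E] [CompleteSpace E] (g : ℕ × ℕ → E)
    (hg : StronglyMeasurable g) (hint : Integrable (fun ω => g (U (n + 1) ω)) P) :
    ∫ ω, g (U (n + 1) ω) ∂P = ∫ ω, transition a b c d g (U n ω) ∂P := by
  rw [← integral_condExp (hU.filtration.le n), integral_congr_ae (hU.condExp_eq h n g hg hint)]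

lemma stronglyMeasurable_composition {E : Type*} [NormedAddCommGroup E] (g : ℕ × ℕ → E) :
    StronglyMeasurable g := by
  borelize E
  refine stronglyMeasurable_iff_measurable_separable.2 ⟨measurable_of_countable _, ?_⟩
  exact (Set.countable_range g).isSeparable

/-- The right side does not mention the process: this is why the limit law depends only on `init`.
-/
lemma IsUrnProcess.integral_eq_iterate (hU : IsUrnProcess a b c d init P U) (h : init ≠ 0) (n : ℕ)
    {E : Type*} [NormedAddCommGroup E] [NormedSpace ℝ E] [CompleteSpace E] (g : ℕ × ℕ → E)
    {C : ℝ} (hC : ∀ x, ‖g x‖ ≤ C) :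
    ∫ ω, g (U n ω) ∂P = (transition a b c d)^[n] g init := by
  induction n generalizing g with
  | zero =>
    rw [integral_congr_ae (g := fun _ => g init) (hU.start.mono fun ω hω => by simp [hω])]
    simp
  | succ n ih =>
    rw [hU.integral_succ h n g (stronglyMeasurable_composition g), Function.iterate_succ_apply]
    · exact ih _ (norm_transition_le a b c d hC)
    · exact Integrable.of_bound ((stronglyMeasurable_composition g).comp_measurable
        (hU.measurable _)).aestronglyMeasurable C (ae_of_all _ fun _ => hC _)

/-- The number of balls in a balanced urn is deterministic. -/
lemma IsUrnProcess.ae_total (hU : IsUrnProcess a b c d init P U) (hbal : a + b = c + d)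
    (h : init ≠ 0) (n : ℕ) :
    ∀ᵐ ω ∂P, (U n ω).1 + (U n ω).2 = init.1 + init.2 + n * (a + b) := by
  induction n with
  | zero => exact hU.start.mono fun ω hω => by simp [hω]
  | succ n ih =>
    -- Indicator of a wrong total; its mean vanishes because either colour adds `a + b = c + d`
    -- balls.
    let g : ℕ × ℕ → ℝ := fun x =>
      if x.1 + x.2 = init.1 + init.2 + (n + 1) * (a + b) then 0 else 1
    have hg (x) : ‖g x‖ ≤ 1 := by simp only [g]; split_ifs <;> simp
    have hint : Integrable (fun ω => g (U (n + 1) ω)) P :=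
      Integrable.of_bound ((stronglyMeasurable_composition g).comp_measurable
        (hU.measurable _)).aestronglyMeasurable 1 (ae_of_all _ fun _ => hg _)
    have h0 : ∫ ω, g (U (n + 1) ω) ∂P = 0 := by
      rw [hU.integral_succ h n g (stronglyMeasurable_composition g) hint]
      refine integral_eq_zero_of_ae (ih.mono fun ω hω => ?_)
      have hne : U n ω ≠ 0 := by
        intro h'
        rw [h'] at hω
        apply h
        simp only [Prod.fst_zero, Prod.snd_zero] at hω
        ext <;> simp <;> omega
      simp only [Pi.zero_apply]
      rw [transition_apply _ _ _ _ _ hne]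
      have e1 : (U n ω).1 + a + ((U n ω).2 + b) = init.1 + init.2 + (n + 1) * (a + b) := by
        linarith
      have e2 : (U n ω).1 + c + ((U n ω).2 + d) = init.1 + init.2 + (n + 1) * (a + b) := by
        linarith
      simp [g, e1, e2]
    rw [integral_eq_zero_iff_of_nonneg (fun ω => by simp only [g]; split_ifs <;> simp) hint] at h0
    filter_upwards [h0] with ω hω
    by_contra hne
    simp [g, hne] at hω

end MarkovChain

/-! ### The martingale of the second projection -/

/-- Where `|f| ≥ C` one has `|f| ≤ f² / C`, so the tails have integral at most `R / C`. -/
lemma uniformIntegrable_of_integral_sq_le {Ω ι : Type*} [MeasurableSpace Ω] {P : Measure Ω}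
    [IsFiniteMeasure P] {f : ι → Ω → ℝ} (hf : ∀ i, AEStronglyMeasurable (f i) P)
    (hint : ∀ i, Integrable (fun ω => f i ω ^ 2) P) {R : ℝ}
    (hR : ∀ i, ∫ ω, f i ω ^ 2 ∂P ≤ R) : UniformIntegrable f 1 P := by
  refine uniformIntegrable_of le_rfl ENNReal.one_ne_top hf fun ε hε => ?_
  have hR' : R / ε ≤ max (R / ε) 1 := le_max_left _ _
  set C : ℝ := max (R / ε) 1
  have hC : 0 < C := lt_of_lt_of_le one_pos (le_max_right _ _)
  refine ⟨⟨C, hC.le⟩, fun i => ?_⟩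
  rw [eLpNorm_one_eq_lintegral_enorm]
  have hle (ω : Ω) : ‖({x | (⟨C, hC.le⟩ : NNReal) ≤ ‖f i x‖₊}.indicator (f i)) ω‖ₑ ≤
      ENNReal.ofReal (f i ω ^ 2 / C) := by
    by_cases h : ω ∈ {x | (⟨C, hC.le⟩ : NNReal) ≤ ‖f i x‖₊}
    · rw [Set.indicator_of_mem h, ← ofReal_norm]
      refine ENNReal.ofReal_le_ofReal ?_
      have h' : C ≤ ‖f i ω‖ := h
      rw [le_div_iff₀ hC, ← sq_abs, ← Real.norm_eq_abs]
      nlinarith [norm_nonneg (f i ω)]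
    · rw [Set.indicator_of_notMem h]; simp
  refine (lintegral_mono hle).trans ?_
  rw [← ofReal_integral_eq_lintegral_ofReal ((hint i).div_const C)
    (ae_of_all _ fun ω => by positivity), integral_div]
  refine ENNReal.ofReal_le_ofReal ?_
  rw [div_le_iff₀ hC]
  rw [div_le_iff₀ hε] at hR'
  linarith [hR i]

/-- The growth factor `∏ (1 + m / (T + i S))` of the mean of the second projection. -/
noncomputable def growth (m S T : ℝ) (n : ℕ) : ℝ := ∏ i ∈ Finset.range n, (1 + m / (T + i * S))

/-! ### Asymptotics of the mean growth factor -/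

section Growth

variable {m S T : ℝ}

lemma growth_pos (hm : 0 < m) (hS : 0 < S) (hT : 0 < T) (n : ℕ) : 0 < growth m S T n :=
  Finset.prod_pos fun i _ => by positivity

lemma growth_succ (n : ℕ) : growth m S T (n + 1) = growth m S T n * (1 + m / (T + n * S)) :=
  Finset.prod_range_succ _ _

/-- The product is a quotient of two rising factorials, hence of two Euler sequences for Gamma.
`Real.GammaSeq` has `n + 1` factors, which is why the last factor of `growth (n + 1)`, tending to
one, is divided out. -/
lemma tendsto_growth (hm : 0 < m) (hS : 0 < S) (hT : 0 < T) :
    Tendsto (fun n : ℕ => growth m S T n / (n : ℝ) ^ (m / S)) atTop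
      (𝓝 (Real.Gamma (T / S) / Real.Gamma (T / S + m / S))) := by
  have h1 := (Real.GammaSeq_tendsto_Gamma (T / S)).div
    (Real.GammaSeq_tendsto_Gamma (T / S + m / S)) (Real.Gamma_pos_of_pos (by positivity)).ne'
  have h2 : Tendsto (fun n : ℕ => (1 + m / (T + n * S))) atTop (𝓝 (1 + 0)) := by
    refine tendsto_const_nhds.add (Tendsto.const_div_atTop ?_ _)
    exact tendsto_atTop_add_const_left _ _ (tendsto_natCast_atTop_atTop.atTop_mul_const hS)
  have h3 := h1.div h2 (by norm_num)
  rw [add_zero, div_one] at h3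
  refine h3.congr' ?_
  filter_upwards [eventually_gt_atTop 0] with n hn
  have hn' : (0 : ℝ) < n := by exact_mod_cast hn
  have key : growth m S T (n + 1) = (∏ j ∈ Finset.range (n + 1), (T / S + m / S + j)) /
      ∏ j ∈ Finset.range (n + 1), (T / S + j) := by
    rw [growth, ← Finset.prod_div_distrib]
    refine Finset.prod_congr rfl fun i _ => ?_
    have : T + i * S ≠ 0 := by positivity
    have : T / S + i ≠ 0 := by positivity
    field_simp
    ring
  have hp : (1 + m / (T + n * S)) ≠ 0 := by positivity
  have hA : (∏ j ∈ Finset.range (n + 1), (T / S + m / S + j)) ≠ 0 :=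
    (Finset.prod_pos fun i _ => by positivity).ne'
  have hB : (∏ j ∈ Finset.range (n + 1), (T / S + j)) ≠ 0 :=
    (Finset.prod_pos fun i _ => by positivity).ne'
  have hf : ((n.factorial : ℕ) : ℝ) ≠ 0 := by positivity
  have hr : (n : ℝ) ^ (T / S) ≠ 0 := by positivity
  have hr' : (n : ℝ) ^ (m / S) ≠ 0 := by positivity
  rw [Pi.div_apply, Pi.div_apply, div_eq_iff hp, div_mul_eq_mul_div, ← growth_succ, key]
  simp only [Real.GammaSeq]
  rw [Real.rpow_add hn']
  field_simp

/-- The terms are of order `n ^ (-2m/S)`; this is where the urn has to be large. -/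
lemma summable_growth (hm : S / 2 < m) (hS : 0 < S) (hT : 0 < T) :
    Summable fun n : ℕ => (1 / growth m S T n) ^ 2 := by
  have hm0 : 0 < m := by linarith
  have hL : 0 < Real.Gamma (T / S) / Real.Gamma (T / S + m / S) :=
    div_pos (Real.Gamma_pos_of_pos (by positivity)) (Real.Gamma_pos_of_pos (by positivity))
  have h1 : 1 < 2 * (m / S) := by
    rw [← mul_div_assoc, lt_div_iff₀ hS]; linarith
  refine summable_of_isBigO_nat (Real.summable_nat_rpow_inv.2 h1) ?_
  have h2 := ((tendsto_growth hm0 hS hT).inv₀ hL.ne').pow 2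
  refine (Asymptotics.isBigO_of_div_tendsto_nhds ?_ _ (h2.congr' ?_))
  · filter_upwards [eventually_gt_atTop 0] with n hn h0
    have : (0 : ℝ) < n := by exact_mod_cast hn
    exact absurd h0 (by positivity)
  · filter_upwards [eventually_gt_atTop 0] with n hn
    have hn' : (0 : ℝ) < n := by exact_mod_cast hn
    rw [Pi.div_apply, mul_comm, Real.rpow_mul hn'.le, Real.rpow_two]
    have := (growth_pos hm0 hS hT n).ne'
    have hr' : (n : ℝ) ^ (m / S) ≠ 0 := by positivity
    field_simp

end Growth

lemma u₂_add (a b c : ℕ) (x y : ℕ × ℕ) : u₂ a b c (x + y) = u₂ a b c x + u₂ a b c y := by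
  simp only [u₂, Prod.fst_add, Prod.snd_add]
  push_cast
  ring

/-! ### One-step moments of the second projection -/

section Moments

variable {a b c d : ℕ}

lemma cast_total_pos {x : ℕ × ℕ} (hx : x ≠ 0) : (0 : ℝ) < x.1 + x.2 := by
  have hx' : 0 < x.1 + x.2 := Nat.pos_of_ne_zero fun h => hx (by ext <;> simp <;> omega)
  exact_mod_cast hx'

/-- A red draw adds `bm/S` to `u₂` and a black draw adds `-cm/S`; weighted by the proportions of
`x`, these average to `m u₂(x)` over the total. -/
lemma transition_u₂ (hbal : a + b = c + d) (hS : 0 < a + b) {x : ℕ × ℕ} (hx : x ≠ 0) :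
    transition a b c d (u₂ a b c) x = u₂ a b c x * (1 + eigm a c / (x.1 + x.2)) := by
  rw [transition_apply _ _ _ _ _ hx]
  have hT := (cast_total_pos hx).ne'
  have hS' : (a : ℝ) + b ≠ 0 := by exact_mod_cast hS.ne'
  have hbal' : (d : ℝ) = a + b - c := by
    have : (a : ℝ) + b = c + d := by exact_mod_cast hbal
    linarith
  simp only [u₂, eigm, smul_eq_mul]
  push_cast
  rw [hbal']
  field_simp
  ring

/-- With `ξ` the increment and `μ` the eigenvalue over the total, `E(u + ξ)² = u² + 2u²μ + E ξ²`.
The first two terms are at most `u²(1 + μ)²`, and `ξ` takes only two values. -/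
lemma transition_u₂_sq_le (hbal : a + b = c + d) (hS : 0 < a + b) {x : ℕ × ℕ} (hx : x ≠ 0) :
    transition a b c d (fun y => u₂ a b c y ^ 2) x ≤
      u₂ a b c x ^ 2 * (1 + eigm a c / (x.1 + x.2)) ^ 2 +
        (u₂ a b c (a, b) ^ 2 + u₂ a b c (c, d) ^ 2) := by
  have h1 := transition_u₂ hbal hS hx
  rw [transition_apply _ _ _ _ _ hx] at h1 ⊢
  have hT := cast_total_pos hx
  have e1 : (x.1 + a, x.2 + b) = x + (a, b) := rfl
  have e2 : (x.1 + c, x.2 + d) = x + (c, d) := rfl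
  rw [e1, e2, u₂_add, u₂_add] at h1 ⊢
  set u := u₂ a b c x
  set p := u₂ a b c (a, b)
  set q := u₂ a b c (c, d)
  set T : ℝ := x.1 + x.2 with hTdef
  have hsum : (x.1 : ℝ) / T + x.2 / T = 1 := by rw [← add_div]; exact div_self hT.ne'
  have hα : 0 ≤ (x.1 : ℝ) / T := by positivity
  have hβ : 0 ≤ (x.2 : ℝ) / T := by positivity
  set α := (x.1 : ℝ) / T
  set β := (x.2 : ℝ) / T
  set μ := eigm a c / T
  simp only [smul_eq_mul] at h1 ⊢
  have h2 : α * p + β * q = u * μ := by linear_combination h1 - u * hsum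
  have h3 : α * (u + p) ^ 2 + β * (u + q) ^ 2 =
      u ^ 2 + 2 * u * (u * μ) + α * p ^ 2 + β * q ^ 2 := by
    rw [← h2]
    linear_combination u ^ 2 * hsum
  rw [h3]
  have hα1 : α ≤ 1 := by linarith
  have hβ1 : β ≤ 1 := by linarith
  nlinarith [sq_nonneg (u * μ), mul_le_mul_of_nonneg_right hα1 (sq_nonneg p),
    mul_le_mul_of_nonneg_right hβ1 (sq_nonneg q)]

end Moments

/-! ### The L²-bounded martingale and its limit -/

section Martingale

variable {a b c d : ℕ} {init : ℕ × ℕ} {Ω : Type*} [MeasurableSpace Ω] {P : Measure Ω}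
  {U : ℕ → Ω → ℕ × ℕ}

/-- The second projection of the urn divided by its mean growth. -/
noncomputable def normalizedProj (a b c : ℕ) (init : ℕ × ℕ) (U : ℕ → Ω → ℕ × ℕ) (n : ℕ) (ω : Ω) :
    ℝ :=
  u₂ a b c (U n ω) / growth (eigm a c) (a + b) (init.1 + init.2) n

variable [IsProbabilityMeasure P]

lemma IsUrnProcess.ae_ne_zero (hU : IsUrnProcess a b c d init P U) (hbal : a + b = c + d)
    (h : init ≠ 0) (n : ℕ) : ∀ᵐ ω ∂P, U n ω ≠ 0 := by
  filter_upwards [hU.ae_total hbal h n] with ω hω h0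
  rw [h0] at hω
  apply h
  simp only [Prod.fst_zero, Prod.snd_zero] at hω
  ext <;> simp <;> omega

/-- The deterministic total leaves only finitely many possible compositions at time `n`. -/
lemma IsUrnProcess.integrable_comp (hU : IsUrnProcess a b c d init P U) (hbal : a + b = c + d)
    (h : init ≠ 0) (n : ℕ) (g : ℕ × ℕ → ℝ) : Integrable (fun ω => g (U n ω)) P := by
  set N := init.1 + init.2 + n * (a + b)
  refine Integrable.of_bound (((stronglyMeasurable_composition g).comp_measurable
    (hU.measurable n)).aestronglyMeasurable)
    (∑ y ∈ Finset.range (N + 1) ×ˢ Finset.range (N + 1), ‖g y‖) ?_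
  filter_upwards [hU.ae_total hbal h n] with ω hω
  refine Finset.single_le_sum (f := fun y => ‖g y‖) (fun _ _ => norm_nonneg _) ?_
  simp only [Finset.mem_product, Finset.mem_range]
  omega

lemma IsUrnProcess.martingale (hU : IsUrnProcess a b c d init P U) (hbal : a + b = c + d)
    (hS : 0 < a + b) (hm : 0 < eigm a c) (h : init ≠ 0) :
    Martingale (normalizedProj a b c init U) hU.filtration P := by
  refine martingale_nat (fun n => ?_) (fun n => ?_) (fun n => ?_)
  · exact (stronglyMeasurable_composition
      (fun x => u₂ a b c x / growth (eigm a c) (a + b) (init.1 + init.2) n)).comp_measurable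
      (hU.measurable_filtration n)
  · exact hU.integrable_comp hbal h n
      (fun x => u₂ a b c x / growth (eigm a c) (a + b) (init.1 + init.2) n)
  · have hT := cast_total_pos h
    have hS' : (0 : ℝ) < a + b := by exact_mod_cast hS
    have hg := growth_pos hm hS' hT
    have h1 := hU.condExp_eq h n
      (fun x => u₂ a b c x / growth (eigm a c) (a + b) (init.1 + init.2) (n + 1))
      (stronglyMeasurable_composition _) (hU.integrable_comp hbal h (n + 1)
        (fun x => u₂ a b c x / growth (eigm a c) (a + b) (init.1 + init.2) (n + 1)))
    symm
    refine h1.trans ?_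
    filter_upwards [hU.ae_total hbal h n, hU.ae_ne_zero hbal h n] with ω hω hne
    have h2 := transition_u₂ hbal hS hne
    have h3 : ((U n ω).1 : ℝ) + (U n ω).2 = init.1 + init.2 + n * (a + b) := by exact_mod_cast hω
    rw [h3] at h2
    have h4 : transition a b c d
        (fun x => u₂ a b c x / growth (eigm a c) (a + b) (init.1 + init.2) (n + 1)) (U n ω) =
        transition a b c d (u₂ a b c) (U n ω) /
          growth (eigm a c) (a + b) (init.1 + init.2) (n + 1) := by
      simp only [transition, integral_div]
    rw [h4, h2, growth_succ, normalizedProj]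
    have h5 : (1 + eigm a c / ((init.1 : ℝ) + init.2 + n * (a + b))) ≠ 0 := by positivity
    rw [mul_div_mul_right _ _ h5]

/-- In the one-step bound the factor `(1 + μ)²` cancels against the growth, leaving only a bounded
term over `growth (i + 1) ^ 2` at each step. -/
lemma IsUrnProcess.integral_sq_le (hU : IsUrnProcess a b c d init P U) (hbal : a + b = c + d)
    (hS : 0 < a + b) (hm : 0 < eigm a c) (h : init ≠ 0) (n : ℕ) :
    ∫ ω, normalizedProj a b c init U n ω ^ 2 ∂P ≤ u₂ a b c init ^ 2 +
      ∑ i ∈ Finset.range n, (u₂ a b c (a, b) ^ 2 + u₂ a b c (c, d) ^ 2) *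
        (1 / growth (eigm a c) (a + b) (init.1 + init.2) (i + 1)) ^ 2 := by
  have hT := cast_total_pos h
  have hS' : (0 : ℝ) < a + b := by exact_mod_cast hS
  induction n with
  | zero =>
    rw [integral_congr_ae (g := fun _ => u₂ a b c init ^ 2)
      (hU.start.mono fun ω hω => by simp [normalizedProj, hω, growth])]
    simp
  | succ n ih =>
    rw [Finset.sum_range_succ, ← add_assoc]
    refine le_trans ?_ (add_le_add_left ih _)
    have hg := growth_pos hm hS' hT n
    have hg1 := growth_pos hm hS' hT (n + 1)
    set G := growth (eigm a c) (a + b) (init.1 + init.2) (n + 1) with hG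
    set g := growth (eigm a c) (a + b) (init.1 + init.2) n
    set B := u₂ a b c (a, b) ^ 2 + u₂ a b c (c, d) ^ 2
    have e1 : ∫ ω, normalizedProj a b c init U (n + 1) ω ^ 2 ∂P =
        (∫ ω, u₂ a b c (U (n + 1) ω) ^ 2 ∂P) / G ^ 2 := by
      simp only [normalizedProj, div_pow, integral_div, hG]
    have e2 := hU.integral_succ h n (fun y => u₂ a b c y ^ 2) (stronglyMeasurable_composition _)
      (hU.integrable_comp hbal h (n + 1) (fun y => u₂ a b c y ^ 2))
    rw [e1, e2, ← integral_div]
    have e3 : (∫ ω, normalizedProj a b c init U n ω ^ 2 ∂P) + B * (1 / G) ^ 2 =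
        ∫ ω, (normalizedProj a b c init U n ω ^ 2 + B * (1 / G) ^ 2) ∂P := by
      have hi : Integrable (fun ω => normalizedProj a b c init U n ω ^ 2) P :=
        hU.integrable_comp hbal h n (fun x => (u₂ a b c x / g) ^ 2)
      rw [integral_add hi (integrable_const _)]
      simp
    rw [e3]
    refine integral_mono_ae
      (hU.integrable_comp hbal h n (fun x => transition a b c d (fun y => u₂ a b c y ^ 2) x / G ^
          2))
      (hU.integrable_comp hbal h n (fun x => (u₂ a b c x / g) ^ 2 + B * (1 / G) ^ 2)) ?_
    filter_upwards [hU.ae_total hbal h n, hU.ae_ne_zero hbal h n] with ω hω hne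
    have h2 := transition_u₂_sq_le hbal hS hne
    have h3 : ((U n ω).1 : ℝ) + (U n ω).2 = init.1 + init.2 + n * (a + b) := by exact_mod_cast hω
    rw [h3] at h2
    have h5 : (0 : ℝ) < 1 + eigm a c / ((init.1 : ℝ) + init.2 + n * (a + b)) := by positivity
    have hGg : G = g * (1 + eigm a c / ((init.1 : ℝ) + init.2 + n * (a + b))) := growth_succ n
    refine (div_le_div_of_nonneg_right h2 (by positivity)).trans_eq ?_
    simp only [normalizedProj]
    change _ = (u₂ a b c (U n ω) / g) ^ 2 + B * (1 / G) ^ 2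
    rw [hGg]
    field_simp
    rfl

/-- Almost sure and mean convergence of the normalised second projection of a large urn. -/
theorem IsUrnProcess.exists_limit (hU : IsUrnProcess a b c d init P U) (hbal : a + b = c + d)
    (hS : 0 < a + b) (hlarge : 1 / 2 < sigma a b c) (h : init ≠ 0) :
    (∀ᵐ ω ∂P, Tendsto (fun n => normProj a b c U n ω) atTop (𝓝 (W a b c U ω))) ∧
      Integrable (W a b c U) P ∧ ∃ κ : ℝ, 0 < κ ∧ ∫ ω, W a b c U ω ∂P = κ * u₂ a b c init := by
  have hT := cast_total_pos h
  have hS' : (0 : ℝ) < a + b := by exact_mod_cast hS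
  have hm2 : ((a : ℝ) + b) / 2 < eigm a c := by
    unfold sigma at hlarge
    rw [lt_div_iff₀ hS'] at hlarge
    linarith
  have hm : 0 < eigm a c := by linarith
  have hmart := hU.martingale hbal hS hm h
  set M := normalizedProj a b c init U with hM
  set B := u₂ a b c (a, b) ^ 2 + u₂ a b c (c, d) ^ 2 with hB
  have hsum : Summable fun i : ℕ => B *
      (1 / growth (eigm a c) (a + b) (init.1 + init.2) (i + 1)) ^ 2 :=
    ((summable_nat_add_iff 1).2 (summable_growth hm2 hS' hT)).mul_left B
  have hunif : UniformIntegrable M 1 P := by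
    refine uniformIntegrable_of_integral_sq_le
      (R := u₂ a b c init ^ 2 + ∑' i : ℕ, B *
        (1 / growth (eigm a c) (a + b) (init.1 + init.2) (i + 1)) ^ 2)
      (fun n => (hmart.integrable n).aestronglyMeasurable)
      (fun n => hU.integrable_comp hbal h n (fun x => (u₂ a b c x /
        growth (eigm a c) (a + b) (init.1 + init.2) n) ^ 2)) (fun n => ?_)
    refine (hU.integral_sq_le hbal hS hm h n).trans (add_le_add_right ?_ _)
    exact hsum.sum_le_tsum _ (fun i _ => by positivity)
  have hlim := hmart.submartingale.ae_tendsto_limitProcess_of_uniformIntegrable hunif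
  set ℓ := hU.filtration.limitProcess M P
  set κ := Real.Gamma ((init.1 + init.2) / (a + b)) /
    Real.Gamma ((init.1 + init.2) / (a + b) + eigm a c / (a + b))
  have hκ : 0 < κ :=
    div_pos (Real.Gamma_pos_of_pos (by positivity)) (Real.Gamma_pos_of_pos (by positivity))
  have hgrow := tendsto_growth hm hS' hT
  have hconv : ∀ᵐ ω ∂P, Tendsto (fun n => normProj a b c U n ω) atTop (𝓝 (ℓ ω * κ)) := by
    filter_upwards [hlim] with ω hω
    refine (hω.mul hgrow).congr fun n => ?_
    have := (growth_pos hm hS' hT n).ne'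
    simp only [hM, normalizedProj, normProj, sigma]
    field_simp
  have hW : (fun ω => ℓ ω * κ) =ᵐ[P] W a b c U := by
    filter_upwards [hconv] with ω hω
    exact hω.limUnder_eq.symm
  obtain ⟨R, hR⟩ := hunif.2.2
  have hℓ : Integrable ℓ P := memLp_one_iff_integrable.1
    (Filtration.memLp_limitProcess_of_eLpNorm_bdd hunif.1 hR)
  refine ⟨?_, (hℓ.mul_const κ).congr hW, κ, hκ, ?_⟩
  · filter_upwards [hconv, hW] with ω h1 h2
    rwa [← h2]
  · rw [← integral_congr_ae hW, integral_mul_const, mul_comm]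
    congr 1
    -- Uniform integrability preserves the mean: it equals that at time `0`, where `growth` is the
    -- empty product.
    have h0 := hmart.ae_eq_condExp_limitProcess hunif 0
    rw [← integral_condExp (hU.filtration.le 0), ← integral_congr_ae h0,
      integral_congr_ae (g := fun _ => u₂ a b c init)
      (hU.start.mono fun ω hω => by simp [hM, normalizedProj, hω, growth])]
    simp

end Martingale

/-! ### Moments of the beta distribution -/

section Beta

lemma measurable_betaPDF (α β : ℝ) : Measurable (betaPDF α β) :=
  (measurable_betaPDFReal α β).ennreal_ofReal

lemma ae_betaMeasure_mem_Ioo (α β : ℝ) : ∀ᵐ v ∂betaMeasure α β, v ∈ Set.Ioo (0 : ℝ) 1 := by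
  rw [betaMeasure, ae_withDensity_iff (measurable_betaPDF α β)]
  refine ae_of_all _ fun v hv => ?_
  by_contra h
  rw [Set.mem_Ioo, not_and_or, not_lt, not_lt] at h
  rcases h with h | h
  · exact hv (betaPDF_eq_zero_of_nonpos h)
  · exact hv (betaPDF_eq_zero_of_one_le h)

lemma betaMeasure_Ioo_pos {α β : ℝ} (hα : 0 < α) (hβ : 0 < β) {p q : ℝ} (hp : 0 ≤ p) (hq : q ≤ 1)
    (hpq : p < q) : 0 < betaMeasure α β (Set.Ioo p q) := by
  rw [pos_iff_ne_zero, betaMeasure, withDensity_apply _ measurableSet_Ioo]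
  intro h
  rw [setLIntegral_eq_zero_iff measurableSet_Ioo
    (measurable_betaPDF α β)] at h
  have h0 : volume (Set.Ioo p q) = 0 := by
    refine measure_mono_null (fun v hv => ?_) (ae_iff.1 h)
    simp only [Set.mem_ofPred_eq, Classical.not_imp]
    refine ⟨hv, ?_⟩
    have := betaPDFReal_pos (hp.trans_lt hv.1) (hv.2.trans_le hq) hα hβ
    exact (ENNReal.ofReal_pos.2 this).ne'
  rw [Real.volume_Ioo, ENNReal.ofReal_eq_zero] at h0
  linarith

/-- The weight only shifts the beta parameters. Negative exponents are allowed while the shifted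
parameters stay positive, and this produces the thresholds on the decay rates. -/
lemma lintegral_rpow_betaMeasure {α β p q : ℝ} (hα : 0 < α) (hβ : 0 < β) (hp : 0 < α + p)
    (hq : 0 < β + q) :
    ∫⁻ v, ENNReal.ofReal (v ^ p * (1 - v) ^ q) ∂betaMeasure α β =
      ENNReal.ofReal (beta (α + p) (β + q) / beta α β) := by
  rw [betaMeasure, lintegral_withDensity_eq_lintegral_mul _
    (measurable_betaPDF α β) (by fun_prop)]
  rw [← mul_one (ENNReal.ofReal (_ / _)), ← lintegral_betaPDF_eq_one hp hq,
    ← lintegral_const_mul _ (measurable_betaPDF _ _)]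
  refine lintegral_congr fun v => ?_
  have hB := beta_pos hα hβ
  have hB' := beta_pos hp hq
  rw [Pi.mul_apply, betaPDF_eq, betaPDF_eq]
  split_ifs with hv
  · have hv' : 0 < 1 - v := by linarith [hv.2]
    rw [← ENNReal.ofReal_mul, ← ENNReal.ofReal_mul (by positivity)]
    · congr 1
      rw [show α + p - 1 = (α - 1) + p by ring, show β + q - 1 = (β - 1) + q by ring,
        Real.rpow_add hv.1, Real.rpow_add hv']
      field_simp
    · have := hv.1
      positivity
  · simp

lemma integrable_rpow_betaMeasure {α β p q : ℝ} (hα : 0 < α) (hβ : 0 < β) (hp : 0 < α + p)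
    (hq : 0 < β + q) : Integrable (fun v => v ^ p * (1 - v) ^ q) (betaMeasure α β) := by
  refine ⟨Measurable.aestronglyMeasurable (by fun_prop), ?_⟩
  rw [hasFiniteIntegral_iff_ofReal, lintegral_rpow_betaMeasure hα hβ hp hq]
  · exact ENNReal.ofReal_lt_top
  · filter_upwards [ae_betaMeasure_mem_Ioo α β] with v hv
    have hv' : 0 < 1 - v := by linarith [hv.2]
    have := hv.1
    simp only [Pi.zero_apply]
    positivity

lemma integral_rpow_betaMeasure {α β p q : ℝ} (hα : 0 < α) (hβ : 0 < β) (hp : 0 < α + p)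
    (hq : 0 < β + q) :
    ∫ v, v ^ p * (1 - v) ^ q ∂betaMeasure α β = beta (α + p) (β + q) / beta α β := by
  rw [integral_eq_lintegral_of_nonneg_ae, lintegral_rpow_betaMeasure hα hβ hp hq,
    ENNReal.toReal_ofReal (div_nonneg (beta_pos hp hq).le (beta_pos hα hβ).le)]
  · filter_upwards [ae_betaMeasure_mem_Ioo α β] with v hv
    have hv' : 0 < 1 - v := by linarith [hv.2]
    have := hv.1
    simp only [Pi.zero_apply]
    positivity
  · exact Measurable.aestronglyMeasurable (by fun_prop)

lemma Gamma_add_natCast {α : ℝ} (hα : 0 < α) (n : ℕ) :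
    Real.Gamma (α + n) = (∏ i ∈ Finset.range n, (α + i)) * Real.Gamma α := by
  induction n with
  | zero => simp
  | succ n ih =>
    rw [Finset.prod_range_succ, Nat.cast_succ, ← add_assoc,
      Real.Gamma_add_one (by positivity), ih]
    ring

/-- For integer exponents the Gamma quotients become rising factorials, the shape in which urn
totals appear. -/
lemma integral_pow_betaMeasure {α β : ℝ} (hα : 0 < α) (hβ : 0 < β) (k l : ℕ) :
    ∫ v, v ^ k * (1 - v) ^ l ∂betaMeasure α β =
      (∏ i ∈ Finset.range k, (α + i)) * (∏ i ∈ Finset.range l, (β + i)) /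
        ∏ i ∈ Finset.range (k + l), (α + β + i) := by
  have h := integral_rpow_betaMeasure hα hβ (p := k) (q := l) (by positivity) (by positivity)
  simp only [Real.rpow_natCast] at h
  rw [h, beta, beta, Gamma_add_natCast hα, Gamma_add_natCast hβ,
    show α + k + (β + l) = α + β + ((k + l : ℕ) : ℝ) by push_cast; ring,
    Gamma_add_natCast (add_pos hα hβ)]
  have h1 := (Real.Gamma_pos_of_pos hα).ne'
  have h2 := (Real.Gamma_pos_of_pos hβ).ne'
  have h3 := (Real.Gamma_pos_of_pos (add_pos hα hβ)).ne'
  have h4 : (∏ i ∈ Finset.range (k + l), (α + β + i)) ≠ 0 :=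
    (Finset.prod_pos fun i _ => by positivity).ne'
  field_simp

end Beta

/-! ### The branching property in discrete time -/

section Generator

/-- The unnormalised transition operator. It is a derivation on multiplicative functions. -/
def generator (a b c d : ℕ) (g : ℕ × ℕ → ℂ) (x : ℕ × ℕ) : ℂ :=
  x.1 * g (x + (a, b)) + x.2 * g (x + (c, d))

variable {a b c d : ℕ}

/-- Leibniz rule for the iterated generator. -/
lemma generator_iterate_add {e : ℕ × ℕ → ℂ} (he : ∀ x y, e (x + y) = e x * e y) (n : ℕ)
    (x y : ℕ × ℕ) : (generator a b c d)^[n] e (x + y) =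
      ∑ ij ∈ Finset.HasAntidiagonal.antidiagonal n, (n.choose ij.1 : ℂ) *
        ((generator a b c d)^[ij.1] e x * (generator a b c d)^[ij.2] e y) := by
  induction n generalizing x y with
  | zero => simp [he]
  | succ n ih =>
    rw [Finset.sum_antidiagonal_choose_succ_mul
      (fun i j => (generator a b c d)^[i] e x * (generator a b c d)^[j] e y)]
    simp only [Function.iterate_succ_apply']
    generalize hG : (generator a b c d)^[n] e = G at ih ⊢
    have h1 (z) : x + y + z = x + z + y := by abel
    have h2 (z) : x + y + z = x + (y + z) := by abel
    simp only [generator, Prod.fst_add, Prod.snd_add]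
    push_cast
    -- A red ball drawn from `x + y` belongs either to `x` or to `y`, and its replacement is
    -- credited to that part.
    have h3 (z) : ((x.1 : ℂ) + y.1) * G (x + y + z) =
        x.1 * G (x + z + y) + y.1 * G (x + (y + z)) := by
      rw [add_mul, ← h1, ← h2]
    have h4 (z) : ((x.2 : ℂ) + y.2) * G (x + y + z) =
        x.2 * G (x + z + y) + y.2 * G (x + (y + z)) := by
      rw [add_mul, ← h1, ← h2]
    rw [h3, h4]
    simp only [ih, Finset.mul_sum]
    rw [← Finset.sum_add_distrib, ← Finset.sum_add_distrib, ← Finset.sum_add_distrib,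
      ← Finset.sum_add_distrib]
    refine Finset.sum_congr rfl fun ij hij => ?_
    have hch : (n.choose ij.2 : ℂ) = n.choose ij.1 := by
      rw [← Finset.HasAntidiagonal.mem_antidiagonal.1 hij, Nat.choose_symm_add]
    rw [hch]
    ring

/-- By balance the total after `i` draws does not depend on the colours drawn, so the normalisations
factor out. -/
lemma generator_iterate_eq (hbal : a + b = c + d) (g : ℕ × ℕ → ℂ) (n : ℕ) {x : ℕ × ℕ}
    (hx : x ≠ 0) : (generator a b c d)^[n] g x =
      (∏ i ∈ Finset.range n, ((x.1 : ℝ) + x.2 + i * (a + b)) : ℝ) *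
        (transition a b c d)^[n] g x := by
  induction n generalizing x with
  | zero => simp
  | succ n ih =>
    have hne (z : ℕ × ℕ) : x + z ≠ 0 := by
      intro h
      apply hx
      simp only [Prod.ext_iff, Prod.fst_add, Prod.snd_add, Prod.fst_zero, Prod.snd_zero] at h
      ext <;> simp <;> omega
    have hT : (x.1 : ℂ) + x.2 ≠ 0 := by exact_mod_cast (cast_total_pos hx).ne'
    have hbal' : (a : ℝ) + b = c + d := by exact_mod_cast hbal
    simp only [Function.iterate_succ_apply']
    rw [generator, transition_apply _ _ _ _ _ hx, ih (hne _), ih (hne _), Finset.prod_range_succ']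
    have e1 (i : ℕ) : ((x + (a, b)).1 : ℝ) + (x + (a, b)).2 + i * (a + b) =
        x.1 + x.2 + (i + 1 : ℕ) * (a + b) := by
      simp only [Prod.fst_add, Prod.snd_add]; push_cast; ring
    have e2 (i : ℕ) : ((x + (c, d)).1 : ℝ) + (x + (c, d)).2 + i * (a + b) =
        x.1 + x.2 + (i + 1 : ℕ) * (a + b) := by
      simp only [Prod.fst_add, Prod.snd_add]; push_cast; linear_combination -hbal'
    simp only [e1, e2]
    have e3 : (x.1 + a, x.2 + b) = x + (a, b) := rfl
    have e4 : (x.1 + c, x.2 + d) = x + (c, d) := rfl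
    rw [e3, e4]
    simp only [Complex.real_smul]
    generalize (∏ i ∈ Finset.range n, ((x.1 : ℝ) + x.2 + (i + 1 : ℕ) * (a + b))) = Q
    push_cast
    field_simp
    ring

/-- The urn started from `x + y` is a beta mixture of independent urns started from `x` and `y`. -/
lemma transition_iterate_add (hbal : a + b = c + d) (hS : 0 < a + b) {e : ℕ × ℕ → ℂ}
    (he : ∀ x y, e (x + y) = e x * e y) (n : ℕ) {x y : ℕ × ℕ} (hx : x ≠ 0) (hy : y ≠ 0) :
    (transition a b c d)^[n] e (x + y) =
      ∫ v, ∑ k ∈ Finset.range (n + 1), ((n.choose k * v ^ k * (1 - v) ^ (n - k) : ℝ) : ℂ) *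
        ((transition a b c d)^[k] e x * (transition a b c d)^[n - k] e y)
          ∂betaMeasure ((x.1 + x.2 : ℝ) / (a + b)) ((y.1 + y.2 : ℝ) / (a + b)) := by
  have hxT := cast_total_pos hx
  have hyT := cast_total_pos hy
  have hS' : (0 : ℝ) < a + b := by exact_mod_cast hS
  set α : ℝ := (x.1 + x.2 : ℝ) / (a + b) with hα
  set β : ℝ := (y.1 + y.2 : ℝ) / (a + b) with hβ
  have hα0 : 0 < α := by positivity
  have hβ0 : 0 < β := by positivity
  have hxy : x + y ≠ 0 := by
    intro h
    apply hx
    simp only [Prod.ext_iff, Prod.fst_add, Prod.snd_add, Prod.fst_zero, Prod.snd_zero] at h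
    ext <;> simp <;> omega
  have hprod {T γ : ℝ} (hT : T = γ * (a + b)) (l : ℕ) :
      ∏ i ∈ Finset.range l, (T + i * (a + b)) =
        ((a : ℝ) + b) ^ l * ∏ i ∈ Finset.range l, (γ + i) := by
    rw [← Finset.card_range l, ← Finset.prod_const, Finset.card_range, ← Finset.prod_mul_distrib]
    exact Finset.prod_congr rfl fun i _ => by rw [hT]; ring
  have hex : (x.1 + x.2 : ℝ) = α * (a + b) := by rw [hα]; field_simp
  have hey : (y.1 + y.2 : ℝ) = β * (a + b) := by rw [hβ]; field_simp
  have hexy : ((x + y).1 + (x + y).2 : ℝ) = (α + β) * (a + b) := by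
    rw [add_mul, ← hex, ← hey]; simp only [Prod.fst_add, Prod.snd_add]; push_cast; ring
  have hi (k l : ℕ) : Integrable (fun v : ℝ => v ^ k * (1 - v) ^ l) (betaMeasure α β) := by
    have := integrable_rpow_betaMeasure hα0 hβ0 (p := k) (q := l) (by positivity) (by positivity)
    simpa only [Real.rpow_natCast] using this
  rw [integral_finsetSum]
  swap
  · intro k _
    have : Integrable (fun v : ℝ => n.choose k * v ^ k * (1 - v) ^ (n - k)) (betaMeasure α β) := by
      simp only [mul_assoc]
      exact (hi _ _).const_mul _
    exact (Integrable.ofReal (𝕜 := ℂ) this).mul_const _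
  have h1 := generator_iterate_add (a := a) (b := b) (c := c) (d := d) he n x y
  rw [generator_iterate_eq hbal e n hxy, Finset.Nat.sum_antidiagonal_eq_sum_range_succ_mk] at h1
  have hP : (∏ i ∈ Finset.range n, (α + β + i)) ≠ 0 :=
    (Finset.prod_pos fun i _ => by positivity).ne'
  have hP' : ((∏ i ∈ Finset.range n, ((x + y).1 + (x + y).2 + i * (a + b) : ℝ) : ℝ) : ℂ) ≠ 0 := by
    rw [hprod hexy]
    exact_mod_cast mul_ne_zero (pow_pos hS' n).ne' hP
  -- After multiplication by the totals the left side is the Leibniz sum; the identity is then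
  -- checked for each number `k` of draws falling in the `x` part.
  rw [← mul_right_inj' hP', h1, Finset.mul_sum]
  refine Finset.sum_congr rfl fun k hk => ?_
  have hk' : k + (n - k) = n := by
    have := Finset.mem_range.1 hk
    omega
  have h2 : ∫ v, ((n.choose k * v ^ k * (1 - v) ^ (n - k) : ℝ) : ℂ) *
        ((transition a b c d)^[k] e x * (transition a b c d)^[n - k] e y) ∂betaMeasure α β =
      ((n.choose k * ((∏ i ∈ Finset.range k, (α + i)) * (∏ i ∈ Finset.range (n - k), (β + i)) /
        ∏ i ∈ Finset.range n, (α + β + i)) : ℝ) : ℂ) *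
        ((transition a b c d)^[k] e x * (transition a b c d)^[n - k] e y) := by
    rw [integral_mul_const, integral_complex_ofReal]
    congr 2
    simp only [mul_assoc]
    rw [integral_const_mul, integral_pow_betaMeasure hα0 hβ0, hk']
  rw [h2, generator_iterate_eq hbal e k hx, generator_iterate_eq hbal e (n - k) hy, hprod hexy,
    hprod hex, hprod hey, ← hk', pow_add]
  simp only [hk']
  have hP2 : ((∏ i ∈ Finset.range n, (α + β + i) : ℝ) : ℂ) ≠ 0 := by exact_mod_cast hP
  push_cast at hP2 ⊢
  field_simp

end Generator

/-! ### Limit laws and their characteristic functions -/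

/-- Balanced large urns with non-triangular replacement matrix. -/
structure IsLarge (a b c d : ℕ) : Prop where
  balance : a + b = c + d
  b_ne_zero : b ≠ 0
  c_ne_zero : c ≠ 0
  half_lt_sigma : 1 / 2 < sigma a b c

namespace IsLarge

variable {a b c d : ℕ}

lemma total_pos (H : IsLarge a b c d) : 0 < a + b := by have := H.b_ne_zero; omega

lemma cast_pos (H : IsLarge a b c d) : (0 : ℝ) < a + b := by exact_mod_cast H.total_pos

lemma sigma_pos (H : IsLarge a b c d) : 0 < sigma a b c := lt_trans (by norm_num) H.half_lt_sigma

lemma eigm_eq (H : IsLarge a b c d) : eigm a c = sigma a b c * (a + b) := by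
  rw [sigma, div_mul_cancel₀ _ H.cast_pos.ne']

lemma eigm_pos (H : IsLarge a b c d) : 0 < eigm a c := by
  rw [H.eigm_eq]; exact mul_pos H.sigma_pos H.cast_pos

lemma sigma_lt_one (H : IsLarge a b c d) : sigma a b c < 1 := by
  rw [sigma, div_lt_one H.cast_pos, eigm]
  have hb : (0 : ℝ) < b := by exact_mod_cast Nat.pos_of_ne_zero H.b_ne_zero
  have hc : (0 : ℝ) < c := by exact_mod_cast Nat.pos_of_ne_zero H.c_ne_zero
  linarith

end IsLarge

/-- The character `x ↦ exp (i θ u₂(x))` of the composition. -/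
noncomputable def phase (a b c : ℕ) (θ : ℝ) (x : ℕ × ℕ) : ℂ :=
  Complex.exp (θ * u₂ a b c x * Complex.I)

lemma norm_phase (a b c : ℕ) (θ : ℝ) (x : ℕ × ℕ) : ‖phase a b c θ x‖ = 1 := by
  rw [phase, ← Complex.ofReal_mul, Complex.norm_exp_ofReal_mul_I]

lemma phase_add (a b c : ℕ) (θ : ℝ) (x y : ℕ × ℕ) :
    phase a b c θ (x + y) = phase a b c θ x * phase a b c θ y := by
  rw [phase, phase, phase, ← Complex.exp_add, u₂_add]
  push_cast
  ring_nf

/-- The characteristic function of the second projection after `n` draws. -/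
noncomputable def projCharFun (a b c d : ℕ) (x : ℕ × ℕ) (n : ℕ) (θ : ℝ) : ℂ :=
  (transition a b c d)^[n] (phase a b c θ) x

lemma norm_projCharFun_le (a b c d : ℕ) (x : ℕ × ℕ) (n : ℕ) (θ : ℝ) :
    ‖projCharFun a b c d x n θ‖ ≤ 1 := by
  unfold projCharFun
  induction n generalizing x with
  | zero => exact (norm_phase a b c θ x).le
  | succ n ih =>
    rw [Function.iterate_succ_apply']
    exact norm_transition_le a b c d ih x

section CharFun

variable {a b c d : ℕ} {init : ℕ × ℕ} {Ω : Type*} [MeasurableSpace Ω] {P : Measure Ω}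
  {U : ℕ → Ω → ℕ × ℕ}

/-- Dominated convergence along the almost sure limit. The argument is allowed to move with `n`,
because the rescalings `(n / (n + 1)) ^ σ` and `(k / n) ^ σ` occur below. -/
lemma IsUrnProcess.tendsto_projCharFun [IsProbabilityMeasure P]
    (hU : IsUrnProcess a b c d init P U) (H : IsLarge a b c d) (h : init ≠ 0) (s : ℝ) :
    Tendsto (fun p : ℝ × ℕ => projCharFun a b c d init p.2 (p.1 / (p.2 : ℝ) ^ sigma a b c))
      (𝓝 s ×ˢ atTop) (𝓝 (charFun (P.map (W a b c U)) s)) := by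
  obtain ⟨hlim, hint, -⟩ := hU.exists_limit H.balance H.total_pos H.half_lt_sigma h
  rw [charFun_apply_real, integral_map hint.aemeasurable (by fun_prop)]
  have e (p : ℝ × ℕ) : projCharFun a b c d init p.2 (p.1 / (p.2 : ℝ) ^ sigma a b c) =
      ∫ ω, Complex.exp (p.1 * normProj a b c U p.2 ω * Complex.I) ∂P := by
    rw [projCharFun, ← hU.integral_eq_iterate h p.2 _ (fun x => (norm_phase _ _ _ _ x).le)]
    refine integral_congr_ae (ae_of_all _ fun ω => ?_)
    simp only [phase, normProj]
    push_cast
    ring_nf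
  simp only [e]
  refine tendsto_integral_filter_of_dominated_convergence (fun _ => 1) ?_ ?_
    (integrable_const _) ?_
  · refine Eventually.of_forall fun p => Measurable.aestronglyMeasurable ?_
    have : Measurable (normProj a b c U p.2) :=
      (measurable_of_countable fun x => u₂ a b c x / (p.2 : ℝ) ^ sigma a b c).comp
        (hU.measurable p.2)
    fun_prop
  · refine Eventually.of_forall fun p => ae_of_all _ fun ω => ?_
    rw [← Complex.ofReal_mul, Complex.norm_exp_ofReal_mul_I]
  · filter_upwards [hlim] with ω hω
    have h1 : Tendsto (fun p : ℝ × ℕ => ((p.1 : ℝ) : ℂ)) (𝓝 s ×ˢ atTop) (𝓝 (s : ℂ)) :=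
      (Complex.continuous_ofReal.tendsto s).comp tendsto_fst
    have h2 : Tendsto (fun p : ℝ × ℕ => ((normProj a b c U p.2 ω : ℝ) : ℂ)) (𝓝 s ×ˢ atTop)
        (𝓝 (W a b c U ω : ℂ)) :=
      (Complex.continuous_ofReal.tendsto _).comp (hω.comp tendsto_snd)
    exact (Complex.continuous_exp.tendsto _).comp ((h1.mul h2).mul_const _)

/-- The law of the limit `W` for the urn started from `x`. -/
noncomputable def law (a b c d : ℕ) (x : ℕ × ℕ) : Measure ℝ :=
  if h : x ≠ (0, 0) then (exists_isUrnProcess a b c d x h).choose.map (W a b c fun n ω => ω n)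
  else Measure.dirac 0

lemma exists_law_eq_map (a b c d : ℕ) {x : ℕ × ℕ} (hx : x ≠ 0) :
    ∃ P : Measure (ℕ → ℕ × ℕ), IsProbabilityMeasure P ∧
      IsUrnProcess a b c d x P (fun n ω => ω n) ∧
      law a b c d x = P.map (W a b c fun n ω => ω n) :=
  have hx' : x ≠ (0, 0) := hx
  ⟨_, (exists_isUrnProcess a b c d x hx').choose_spec.1,
    (exists_isUrnProcess a b c d x hx').choose_spec.2, by rw [law, dif_pos hx']⟩

lemma IsLarge.isProbabilityMeasure_law (H : IsLarge a b c d) (x : ℕ × ℕ) :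
    IsProbabilityMeasure (law a b c d x) := by
  by_cases hx : x = 0
  · rw [law, dif_neg (by rw [hx]; simp [Prod.ext_iff])]
    infer_instance
  · obtain ⟨P, hP, hU, e⟩ := exists_law_eq_map a b c d hx
    obtain ⟨-, hint, -⟩ := hU.exists_limit H.balance H.total_pos H.half_lt_sigma hx
    rw [e]
    exact Measure.isProbabilityMeasure_map hint.aemeasurable

lemma IsLarge.tendsto_projCharFun (H : IsLarge a b c d) {x : ℕ × ℕ} (hx : x ≠ 0) (s : ℝ) :
    Tendsto (fun p : ℝ × ℕ => projCharFun a b c d x p.2 (p.1 / (p.2 : ℝ) ^ sigma a b c))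
      (𝓝 s ×ˢ atTop) (𝓝 (charFun (law a b c d x) s)) := by
  obtain ⟨P, hP, hU, e⟩ := exists_law_eq_map a b c d hx
  rw [e]
  exact hU.tendsto_projCharFun H hx s

lemma IsUrnProcess.map_W_eq_law [IsProbabilityMeasure P] (hU : IsUrnProcess a b c d init P U)
    (H : IsLarge a b c d) (h : init ≠ 0) : P.map (W a b c U) = law a b c d init := by
  have := H.isProbabilityMeasure_law init
  obtain ⟨-, hint, -⟩ := hU.exists_limit H.balance H.total_pos H.half_lt_sigma h
  have := Measure.isProbabilityMeasure_map (μ := P) hint.aemeasurable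
  refine Measure.ext_of_charFun (funext fun s => ?_)
  exact tendsto_nhds_unique (hU.tendsto_projCharFun H h s) (H.tendsto_projCharFun h s)

lemma IsLarge.integral_law (H : IsLarge a b c d) {x : ℕ × ℕ} (hx : x ≠ 0) :
    ∃ κ : ℝ, 0 < κ ∧ ∫ y, y ∂law a b c d x = κ * u₂ a b c x := by
  obtain ⟨P, hP, hU, e⟩ := exists_law_eq_map a b c d hx
  obtain ⟨-, hint, κ, hκ, h⟩ := hU.exists_limit H.balance H.total_pos H.half_lt_sigma hx
  refine ⟨κ, hκ, ?_⟩
  rw [e, integral_map hint.aemeasurable (by fun_prop), h]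

/-- A deterministic first draw does not change the limit law. -/
lemma IsLarge.law_eq_of_transition (H : IsLarge a b c d) {x y : ℕ × ℕ} (hx : x ≠ 0) (hy : y ≠ 0)
    (hxy : ∀ g : ℕ × ℕ → ℂ, transition a b c d g x = g y) : law a b c d x = law a b c d y := by
  have := H.isProbabilityMeasure_law x
  have := H.isProbabilityMeasure_law y
  refine Measure.ext_of_charFun (funext fun t => ?_)
  set σ := sigma a b c
  have h1 : Tendsto (fun n : ℕ => (t, n + 1)) atTop (𝓝 t ×ˢ atTop) :=
    tendsto_const_nhds.prodMk (tendsto_add_atTop_nat 1)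
  -- `n + 1` draws from `x` are `n` draws from `y`; this factor corrects the normalisation from `(n
  -- + 1) ^ σ` to `n ^ σ`.
  have h2 : Tendsto (fun n : ℕ => (t * ((n : ℝ) / (n + 1)) ^ σ, n)) atTop (𝓝 t ×ˢ atTop) := by
    refine Tendsto.prodMk ?_ tendsto_id
    have h3 := ((tendsto_natCast_div_add_atTop (𝕜 := ℝ) 1).rpow_const
      (Or.inr H.sigma_pos.le) (p := σ)).const_mul t
    simpa using h3
  refine tendsto_nhds_unique ((H.tendsto_projCharFun hx t).comp h1)
    (((H.tendsto_projCharFun hy t).comp h2).congr' ?_)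
  filter_upwards [eventually_gt_atTop 0] with n hn
  have hn' : (0 : ℝ) < n := by exact_mod_cast hn
  simp only [Function.comp_apply, projCharFun]
  rw [Function.iterate_succ_apply', hxy]
  refine congrArg (fun θ => (transition a b c d)^[n] (phase a b c θ) y) ?_
  change t * (n / (n + 1) : ℝ) ^ σ / (n : ℝ) ^ σ = t / ((n + 1 : ℕ) : ℝ) ^ σ
  rw [Real.div_rpow hn'.le (by positivity)]
  have : (n : ℝ) ^ σ ≠ 0 := by positivity
  push_cast
  field_simp

lemma IsLarge.law_red (H : IsLarge a b c d) : law a b c d (1, 0) = law a b c d (a + 1, b) := by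
  refine H.law_eq_of_transition (by simp) (by simp) fun g => ?_
  rw [transition_apply _ _ _ _ _ (by simp)]
  simp [add_comm]

lemma IsLarge.law_black (H : IsLarge a b c d) : law a b c d (0, 1) = law a b c d (c, d + 1) := by
  refine H.law_eq_of_transition (by simp) (by simp) fun g => ?_
  rw [transition_apply _ _ _ _ _ (by simp)]
  simp [add_comm]

end CharFun

/-! ### The beta mixture in the limit -/

/-- The filter of pairs `(n, k)` with `k ≤ n`, `n → ∞` and `k / n → v`. -/
noncomputable def proportionFilter (v : ℝ) : Filter (ℕ × ℕ) :=
  comap (fun p : ℕ × ℕ => (p.2 : ℝ) / p.1) (𝓝 v) ⊓ comap Prod.fst atTop ⊓ 𝓟 {p | p.2 ≤ p.1}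

/-- The weak law of large numbers for the binomial law. When `k / n` is near `v` the terms are close
to `g`; elsewhere the difference is at most `2`, and Chebyshev's inequality with variance `v (1 - v)
/ n` applies. -/
lemma tendsto_sum_binomial {G : ℕ → ℕ → ℂ} {g : ℂ} {v : ℝ} (hv : v ∈ Set.Icc (0 : ℝ) 1)
    (hG : ∀ n k, ‖G n k‖ ≤ 1) (hg : ‖g‖ ≤ 1)
    (h : Tendsto (fun p : ℕ × ℕ => G p.1 p.2) (proportionFilter v) (𝓝 g)) :
    Tendsto (fun n => ∑ k ∈ Finset.range (n + 1),
      ((n.choose k * v ^ k * (1 - v) ^ (n - k) : ℝ) : ℂ) * G n k) atTop (𝓝 g) := by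
  rw [Metric.tendsto_atTop]
  intro ε hε
  have h1 := h (Metric.ball_mem_nhds g (half_pos hε))
  rw [mem_map, proportionFilter, inf_assoc, ((Metric.nhds_basis_ball.comap _).inf
    ((atTop_basis.comap _).inf_principal _)).mem_iff] at h1
  obtain ⟨⟨δ, N⟩, ⟨hδ, -⟩, hsub⟩ := h1
  simp only at hδ
  -- For `n > N'` the Chebyshev contribution `2 / (δ² n)` is below `ε / 2`.
  obtain ⟨N', hN'⟩ := exists_nat_gt (2 / δ ^ 2 / (ε / 2))
  refine ⟨max N (N' + 1), fun n hn => ?_⟩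
  have hnN : N ≤ n := (le_max_left _ _).trans hn
  have hnN' : N' + 1 ≤ n := (le_max_right _ _).trans hn
  have hn0 : n ≠ 0 := by omega
  have hnpos : (0 : ℝ) < n := by positivity
  set w : ℕ → ℝ := fun k => n.choose k * v ^ k * (1 - v) ^ (n - k)
  have hw (k : ℕ) : 0 ≤ w k := by
    have h1 := hv.1
    have h2 := sub_nonneg.2 hv.2
    positivity
  have hsum : ∑ k ∈ Finset.range (n + 1), w k = 1 := by
    have := bernstein.probability n ⟨v, hv⟩
    rw [Finset.sum_range]
    simpa only [bernstein_apply] using this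
  have hvar : ∑ k ∈ Finset.range (n + 1), (v - k / n) ^ 2 * w k = v * (1 - v) / n := by
    have := bernstein.variance hn0 ⟨v, hv⟩
    rw [Finset.sum_range]
    simpa only [bernstein_apply, bernstein.z] using this
  have hterm (k : ℕ) (hk : k ∈ Finset.range (n + 1)) :
      ‖(w k : ℂ) * (G n k - g)‖ ≤ ε / 2 * w k + 2 / δ ^ 2 * ((v - k / n) ^ 2 * w k) := by
    rw [norm_mul, Complex.norm_real, Real.norm_of_nonneg (hw k)]
    by_cases hkv : |(k : ℝ) / n - v| < δ
    · have hmem : (n, k) ∈ (fun p : ℕ × ℕ => G p.1 p.2) ⁻¹' Metric.ball g (ε / 2) :=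
        hsub ⟨by simpa [Real.dist_eq] using hkv, by simpa using hnN,
          by have := Finset.mem_range.1 hk; simpa using (by omega : k ≤ n)⟩
      have h2 : ‖G n k - g‖ < ε / 2 := by simpa [dist_eq_norm] using hmem
      have h3 : 0 ≤ 2 / δ ^ 2 * ((v - k / n) ^ 2 * w k) := by
        have := hw k
        positivity
      nlinarith [mul_le_mul_of_nonneg_left h2.le (hw k)]
    · have h2 : ‖G n k - g‖ ≤ 2 := (norm_sub_le _ _).trans (by linarith [hG n k])
      have h3 : δ ^ 2 ≤ (v - k / n) ^ 2 := by
        rw [← sq_abs (v - k / n), abs_sub_comm]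
        exact pow_le_pow_left₀ hδ.le (not_lt.1 hkv) 2
      have h4 : 2 ≤ 2 / δ ^ 2 * (v - k / n) ^ 2 := by
        rw [div_mul_eq_mul_div, le_div_iff₀ (by positivity)]
        linarith
      have h5 : 0 ≤ ε / 2 * w k := by
        have := hw k
        positivity
      calc w k * ‖G n k - g‖ ≤ w k * (2 / δ ^ 2 * (v - k / n) ^ 2) :=
            mul_le_mul_of_nonneg_left (h2.trans h4) (hw k)
        _ ≤ _ := by linarith
  have hsumC : ∑ k ∈ Finset.range (n + 1), (w k : ℂ) = 1 := by exact_mod_cast hsum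
  have hdiff : ∑ k ∈ Finset.range (n + 1), (w k : ℂ) * G n k - g =
      ∑ k ∈ Finset.range (n + 1), (w k : ℂ) * (G n k - g) := by
    simp only [mul_sub, Finset.sum_sub_distrib]
    rw [← Finset.sum_mul, hsumC, one_mul]
  rw [dist_eq_norm]
  change ‖∑ k ∈ Finset.range (n + 1), (w k : ℂ) * G n k - g‖ < ε
  rw [hdiff]
  refine (norm_sum_le_of_le _ hterm).trans_lt ?_
  rw [Finset.sum_add_distrib, ← Finset.mul_sum, ← Finset.mul_sum, hsum, hvar]
  have h6 : v * (1 - v) / n ≤ 1 / n := by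
    gcongr
    nlinarith [hv.1, hv.2]
  have h7 : 2 / δ ^ 2 * (1 / n) < ε / 2 := by
    rw [mul_one_div, div_lt_iff₀ hnpos]
    rw [div_lt_iff₀ (by positivity)] at hN'
    have : (N' : ℝ) ≤ n := by exact_mod_cast (by omega : N' ≤ n)
    nlinarith
  have h8 : 2 / δ ^ 2 * (v * (1 - v) / n) ≤ 2 / δ ^ 2 * (1 / n) := by gcongr
  linarith

section Mixture

variable {a b c d : ℕ}

/-- Given `v`, about `vn` of the `n` draws fall in the `x` part, so scaling by `n ^ σ` instead of
`(vn) ^ σ` produces the factor `v ^ σ`; similarly for `y`. -/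
lemma IsLarge.charFun_law_add (H : IsLarge a b c d) {x y : ℕ × ℕ} (hx : x ≠ 0) (hy : y ≠ 0)
    (t : ℝ) :
    charFun (law a b c d (x + y)) t = ∫ v, charFun (law a b c d x) (v ^ sigma a b c * t) *
      charFun (law a b c d y) ((1 - v) ^ sigma a b c * t)
        ∂betaMeasure ((x.1 + x.2 : ℝ) / (a + b)) ((y.1 + y.2 : ℝ) / (a + b)) := by
  have hxT := cast_total_pos hx
  have hyT := cast_total_pos hy
  have hS' := H.cast_pos
  have hxy : x + y ≠ 0 := by
    intro h
    apply hx
    simp only [Prod.ext_iff, Prod.fst_add, Prod.snd_add, Prod.fst_zero, Prod.snd_zero] at h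
    ext <;> simp <;> omega
  have hprobx := H.isProbabilityMeasure_law x
  have hproby := H.isProbabilityMeasure_law y
  set α : ℝ := (x.1 + x.2 : ℝ) / (a + b) with hα
  set β : ℝ := (y.1 + y.2 : ℝ) / (a + b) with hβ
  have hprob : IsProbabilityMeasure (betaMeasure α β) :=
    isProbabilityMeasureBeta (by positivity) (by positivity)
  set σ := sigma a b c
  have h1 : Tendsto (fun n : ℕ => (t, n)) atTop (𝓝 t ×ˢ atTop) :=
    tendsto_const_nhds.prodMk tendsto_id
  refine tendsto_nhds_unique ((H.tendsto_projCharFun hxy t).comp h1) ?_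
  simp only [Function.comp_def, projCharFun]
  simp only [transition_iterate_add H.balance H.total_pos (phase_add a b c _) _ hx hy]
  set G : ℕ → ℕ → ℂ := fun n k => projCharFun a b c d x k (t / (n : ℝ) ^ σ) *
    projCharFun a b c d y (n - k) (t / (n : ℝ) ^ σ) with hGdef
  have hG (n k) : ‖G n k‖ ≤ 1 := by
    rw [norm_mul]
    exact mul_le_one₀ (norm_projCharFun_le _ _ _ _ _ _ _) (norm_nonneg _)
      (norm_projCharFun_le _ _ _ _ _ _ _)
  refine tendsto_integral_filter_of_dominated_convergence (fun _ => 1) ?_ ?_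
    (integrable_const _) ?_
  · refine Eventually.of_forall fun n => Measurable.aestronglyMeasurable ?_
    fun_prop
  · refine Eventually.of_forall fun n => ?_
    filter_upwards [ae_betaMeasure_mem_Ioo α β] with v hv
    have hv' : v ∈ Set.Icc (0 : ℝ) 1 := ⟨hv.1.le, hv.2.le⟩
    have hsum : ∑ k ∈ Finset.range (n + 1), (n.choose k * v ^ k * (1 - v) ^ (n - k) : ℝ) = 1 := by
      have := bernstein.probability n ⟨v, hv'⟩
      rw [Finset.sum_range]
      simpa only [bernstein_apply] using this
    refine (norm_sum_le_of_le _ fun k _ => ?_).trans_eq hsum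
    have h2 := hv.1
    have h3 := sub_pos.2 hv.2
    rw [norm_mul, Complex.norm_real, Real.norm_of_nonneg (by positivity)]
    exact mul_le_of_le_one_right (by positivity) (hG n k)
  · filter_upwards [ae_betaMeasure_mem_Ioo α β] with v hv
    have hv' : v ∈ Set.Icc (0 : ℝ) 1 := ⟨hv.1.le, hv.2.le⟩
    refine tendsto_sum_binomial hv' hG ?_ ?_
    · rw [norm_mul]
      exact mul_le_one₀ (norm_charFun_le_one _) (norm_nonneg _) (norm_charFun_le_one _)
    · have hr : Tendsto (fun p : ℕ × ℕ => (p.2 : ℝ) / p.1) (proportionFilter v) (𝓝 v) :=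
        tendsto_comap.mono_left (inf_le_left.trans inf_le_left)
      have hn : Tendsto (fun p : ℕ × ℕ => p.1) (proportionFilter v) atTop :=
        tendsto_comap.mono_left (inf_le_left.trans inf_le_right)
      have hn' : Tendsto (fun p : ℕ × ℕ => (p.1 : ℝ)) (proportionFilter v) atTop :=
        tendsto_natCast_atTop_atTop.comp hn
      have hle : ∀ᶠ p in proportionFilter v, p.2 ≤ p.1 := by
        have : {p : ℕ × ℕ | p.2 ≤ p.1} ∈ proportionFilter v :=
          mem_inf_of_right (mem_principal_self _)
        exact this
      have hpos : ∀ᶠ p in proportionFilter v, 0 < p.1 := hn.eventually_gt_atTop 0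
      -- Both parts receive infinitely many draws since `0 < v < 1` almost surely.
      have hk : Tendsto (fun p : ℕ × ℕ => p.2) (proportionFilter v) atTop := by
        rw [← tendsto_natCast_atTop_iff (R := ℝ)]
        refine (Tendsto.pos_mul_atTop hv.1 hr hn').congr' ?_
        filter_upwards [hpos] with p hp
        have : (p.1 : ℝ) ≠ 0 := by exact_mod_cast hp.ne'
        field_simp
      have hr' : Tendsto (fun p : ℕ × ℕ => ((p.1 - p.2 : ℕ) : ℝ) / p.1) (proportionFilter v)
          (𝓝 (1 - v)) := by
        refine (hr.const_sub 1).congr' ?_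
        filter_upwards [hpos, hle] with p hp hp'
        have : (p.1 : ℝ) ≠ 0 := by exact_mod_cast hp.ne'
        rw [Nat.cast_sub hp', sub_div, div_self this]
      have hk' : Tendsto (fun p : ℕ × ℕ => p.1 - p.2) (proportionFilter v) atTop := by
        rw [← tendsto_natCast_atTop_iff (R := ℝ)]
        refine (Tendsto.pos_mul_atTop (sub_pos.2 hv.2) hr' hn').congr' ?_
        filter_upwards [hpos] with p hp
        have : (p.1 : ℝ) ≠ 0 := by exact_mod_cast hp.ne'
        field_simp
      have key {z : ℕ × ℕ} (hz : z ≠ 0) {w : ℝ} {k : ℕ × ℕ → ℕ}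
          (hrw : Tendsto (fun p : ℕ × ℕ => (k p : ℝ) / p.1) (proportionFilter v) (𝓝 w))
          (hkt : Tendsto k (proportionFilter v) atTop) :
          Tendsto (fun p : ℕ × ℕ => projCharFun a b c d z (k p) (t / (p.1 : ℝ) ^ σ))
            (proportionFilter v) (𝓝 (charFun (law a b c d z) (w ^ σ * t))) := by
        have h2 : Tendsto (fun p : ℕ × ℕ => (((k p : ℝ) / p.1) ^ σ * t, k p)) (proportionFilter v)
            (𝓝 (w ^ σ * t) ×ˢ atTop) :=
          ((hrw.rpow_const (Or.inr H.sigma_pos.le)).mul_const t).prodMk hkt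
        refine ((H.tendsto_projCharFun hz _).comp h2).congr' ?_
        filter_upwards [hpos, hkt.eventually_gt_atTop 0] with p hp hkp
        have hp' : (0 : ℝ) < p.1 := by exact_mod_cast hp
        have hkp' : (0 : ℝ) < k p := by exact_mod_cast hkp
        simp only [Function.comp_apply]
        congr 1
        have h3 : (p.1 : ℝ) ^ σ ≠ 0 := by positivity
        have h4 : (k p : ℝ) ^ σ ≠ 0 := by positivity
        rw [Real.div_rpow hkp'.le hp'.le]
        change _ / (k p : ℝ) ^ σ = _
        field_simp
      exact (key hx hr hk).mul (key hy hr' hk')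

/-- The limit law started from `x + y` is a beta mixture of the laws started from `x` and `y`. -/
lemma IsLarge.law_add (H : IsLarge a b c d) {x y : ℕ × ℕ} (hx : x ≠ 0) (hy : y ≠ 0) :
    law a b c d (x + y) =
      ((betaMeasure ((x.1 + x.2 : ℝ) / (a + b)) ((y.1 + y.2 : ℝ) / (a + b))).prod
        ((law a b c d x).prod (law a b c d y))).map
        (fun p => p.1 ^ sigma a b c * p.2.1 + (1 - p.1) ^ sigma a b c * p.2.2) := by
  have hxT := cast_total_pos hx
  have hyT := cast_total_pos hy
  have hS' := H.cast_pos
  have := H.isProbabilityMeasure_law x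
  have := H.isProbabilityMeasure_law y
  have := H.isProbabilityMeasure_law (x + y)
  have hprob := isProbabilityMeasureBeta (α := (x.1 + x.2 : ℝ) / (a + b))
    (β := (y.1 + y.2 : ℝ) / (a + b)) (by positivity) (by positivity)
  have hmeas : Measurable fun p : ℝ × ℝ × ℝ =>
    p.1 ^ sigma a b c * p.2.1 + (1 - p.1) ^ sigma a b c * p.2.2 := by fun_prop
  have := Measure.isProbabilityMeasure_map (μ := (betaMeasure ((x.1 + x.2 : ℝ) / (a + b))
    ((y.1 + y.2 : ℝ) / (a + b))).prod ((law a b c d x).prod (law a b c d y))) hmeas.aemeasurable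
  refine Measure.ext_of_charFun (funext fun t => ?_)
  rw [H.charFun_law_add hx hy, charFun_apply_real, integral_map hmeas.aemeasurable (by fun_prop),
    integral_prod]
  · refine integral_congr_ae (ae_of_all _ fun v => ?_)
    simp only
    rw [charFun_apply_real, charFun_apply_real, ← integral_prod_mul]
    refine integral_congr_ae (ae_of_all _ fun p => ?_)
    simp only
    rw [← Complex.exp_add]
    push_cast
    ring_nf
  · refine Integrable.of_bound (C := 1) (Measurable.aestronglyMeasurable (by fun_prop))
      (ae_of_all _ fun p => ?_)
    rw [← Complex.ofReal_mul, Complex.norm_exp_ofReal_mul_I]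

end Mixture

/-! ### Supports of the limit laws -/

section Support

variable {a b c d : ℕ}

lemma IsLarge.c_lt_a (H : IsLarge a b c d) : c < a := by
  have := H.eigm_pos
  rw [eigm] at this
  exact_mod_cast sub_pos.1 this

/-- The beta law charges every neighbourhood of an interior `v`, so the product measure charges
neighbourhoods of `(v, p, q)`, and the mixing map is continuous. The endpoints `v = 0, 1` follow
because supports are closed. -/
lemma IsLarge.mem_support_law_add (H : IsLarge a b c d) {x y : ℕ × ℕ} (hx : x ≠ 0) (hy : y ≠ 0)
    {p q v : ℝ} (hp : p ∈ (law a b c d x).support) (hq : q ∈ (law a b c d y).support)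
    (hv : v ∈ Set.Icc (0 : ℝ) 1) :
    v ^ sigma a b c * p + (1 - v) ^ sigma a b c * q ∈ (law a b c d (x + y)).support := by
  have hxT := cast_total_pos hx
  have hyT := cast_total_pos hy
  have hS' := H.cast_pos
  have := H.isProbabilityMeasure_law x
  have := H.isProbabilityMeasure_law y
  have hσ := H.sigma_pos
  have hprob := isProbabilityMeasureBeta (α := (x.1 + x.2 : ℝ) / (a + b))
    (β := (y.1 + y.2 : ℝ) / (a + b)) (by positivity) (by positivity)
  have hcont : Continuous fun p : ℝ × ℝ × ℝ =>
      p.1 ^ sigma a b c * p.2.1 + (1 - p.1) ^ sigma a b c * p.2.2 := by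
    refine ((continuous_fst.rpow_const fun _ => Or.inr hσ.le).mul (by fun_prop)).add
      (((continuous_const.sub continuous_fst).rpow_const fun _ => Or.inr hσ.le).mul (by fun_prop))
  have hclosed : IsClosed {v : ℝ | v ^ sigma a b c * p + (1 - v) ^ sigma a b c * q ∈
      (law a b c d (x + y)).support} :=
    Measure.isClosed_support.preimage (hcont.comp (by fun_prop : Continuous fun v => (v, p, q)))
  suffices h : Set.Ioo (0 : ℝ) 1 ⊆ {v : ℝ | v ^ sigma a b c * p + (1 - v) ^ sigma a b c * q ∈
      (law a b c d (x + y)).support} by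
    rw [← closure_Ioo zero_ne_one] at hv
    exact closure_minimal h hclosed hv
  intro v hv
  rw [Set.mem_ofPred_eq, Measure.mem_support_iff_forall]
  intro N hN
  have hN' := hcont.continuousAt.preimage_mem_nhds (x := (v, p, q)) hN
  rw [nhds_prod_eq, nhds_prod_eq, mem_prod_iff] at hN'
  obtain ⟨A, hA, B, hB, hAB⟩ := hN'
  obtain ⟨B₁, hB₁, B₂, hB₂, hBB⟩ := mem_prod_iff.1 hB
  rw [Measure.mem_support_iff_forall] at hp hq
  have hA0 : 0 < betaMeasure ((x.1 + x.2 : ℝ) / (a + b)) ((y.1 + y.2 : ℝ) / (a + b)) A := by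
    obtain ⟨l, u, hlu, hsub⟩ := mem_nhds_iff_exists_Ioo_subset.1
        (inter_mem hA (Ioo_mem_nhds hv.1 hv.2))
    have hsub' : Set.Ioo (max l 0) (min u 1) ⊆ A := fun w hw =>
      (hsub ⟨(le_max_left _ _).trans_lt hw.1, hw.2.trans_le (min_le_left _ _)⟩).1
    refine lt_of_lt_of_le ?_ (measure_mono hsub')
    refine betaMeasure_Ioo_pos (by positivity) (by positivity) (le_max_right _ _)
      (min_le_right _ _) ?_
    exact (max_lt hlu.1 hv.1).trans (lt_min hlu.2 hv.2)
  rw [H.law_add hx hy]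
  refine lt_of_lt_of_le ?_ (Measure.le_map_apply hcont.measurable.aemeasurable N)
  refine lt_of_lt_of_le ?_ (measure_mono hAB)
  rw [Measure.prod_prod]
  refine ENNReal.mul_pos hA0.ne' ?_
  refine (lt_of_lt_of_le ?_ (measure_mono hBB)).ne'
  rw [Measure.prod_prod]
  exact ENNReal.mul_pos (hp _ hB₁).ne' (hq _ hB₂).ne'

lemma IsLarge.support_law_nonempty (H : IsLarge a b c d) (x : ℕ × ℕ) :
    (law a b c d x).support.Nonempty := by
  have := H.isProbabilityMeasure_law x
  exact nonempty_of_mem (Measure.support_mem_ae (μ := law a b c d x))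

lemma IsLarge.support_law_subset_left (H : IsLarge a b c d) {x y : ℕ × ℕ} (hx : x ≠ 0)
    (hy : y ≠ 0) : (law a b c d x).support ⊆ (law a b c d (x + y)).support := by
  intro p hp
  obtain ⟨q, hq⟩ := H.support_law_nonempty y
  have := H.mem_support_law_add hx hy hp hq (v := 1) (by simp)
  simpa [H.sigma_pos.ne'] using this

lemma exists_pos_mem_support {μ : Measure ℝ} (h : 0 < ∫ y, y ∂μ) : ∃ p ∈ μ.support, 0 < p := by
  by_contra! hle
  refine h.not_ge (integral_nonpos_of_ae ?_)
  filter_upwards [Measure.support_mem_ae (μ := μ)] with y hy using hle y hy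

lemma exists_neg_mem_support {μ : Measure ℝ} (h : ∫ y, y ∂μ < 0) : ∃ p ∈ μ.support, p < 0 := by
  by_contra! hle
  refine h.not_ge (integral_nonneg_of_ae ?_)
  filter_upwards [Measure.support_mem_ae (μ := μ)] with y hy using hle y hy

/-- After its forced first draw each one-ball urn contains a ball of the other colour, as `b, c ≠
0`, and adding balls only enlarges the support. -/
lemma IsLarge.support_law_red_eq_black (H : IsLarge a b c d) :
    (law a b c d (1, 0)).support = (law a b c d (0, 1)).support := by
  have hb := Nat.pos_of_ne_zero H.b_ne_zero
  have hc := Nat.pos_of_ne_zero H.c_ne_zero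
  refine subset_antisymm ?_ ?_
  · rw [H.law_black, show (c, d + 1) = (1, 0) + (c - 1, d + 1) by
      simp only [Prod.mk_add_mk]; congr 1 <;> omega]
    exact H.support_law_subset_left (by simp) (by simp)
  · rw [H.law_red, show (a + 1, b) = (0, 1) + (a + 1, b - 1) by
      simp only [Prod.mk_add_mk]; congr 1 <;> omega]
    exact H.support_law_subset_left (by simp) (by simp)

theorem IsLarge.support_law_red (H : IsLarge a b c d) :
    (law a b c d (1, 0)).support = Set.univ := by
  have hσ := H.sigma_pos
  have ha := H.c_lt_a
  set K := (law a b c d (1, 0)).support with hK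
  set σ := sigma a b c
  have hmix {p q v : ℝ} (hp : p ∈ K) (hq : q ∈ K) (hv : v ∈ Set.Icc (0 : ℝ) 1) :
      v ^ σ * p + (1 - v) ^ σ * q ∈ K := by
    -- Since `a > c`, the composition `(a + 1, b)` contains two red balls.
    have h1 : (law a b c d ((1, 0) + (1, 0))).support ⊆ K := by
      rw [hK, H.law_red, show (a + 1, b) = ((1, 0) + (1, 0)) + (a - 1, b) by
        simp only [Prod.mk_add_mk]; congr 1 <;> omega]
      refine H.support_law_subset_left (by simp) ?_
      simp [H.b_ne_zero]
    exact h1 (H.mem_support_law_add (by simp) (by simp) hp hq hv)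
  have hbS : (0 : ℝ) < b := by exact_mod_cast Nat.pos_of_ne_zero H.b_ne_zero
  have hcS : (0 : ℝ) < c := by exact_mod_cast Nat.pos_of_ne_zero H.c_ne_zero
  have hS := H.cast_pos
  obtain ⟨p, hpK, hp⟩ : ∃ p ∈ K, 0 < p := by
    obtain ⟨κ, hκ, h⟩ := H.integral_law (x := (1, 0)) (by simp)
    refine exists_pos_mem_support ?_
    rw [h]
    simp only [u₂]
    norm_num
    positivity
  obtain ⟨q, hqK, hq⟩ : ∃ q ∈ K, q < 0 := by
    obtain ⟨κ, hκ, h⟩ := H.integral_law (x := (0, 1)) (by simp)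
    rw [hK, H.support_law_red_eq_black]
    refine exists_neg_mem_support ?_
    rw [h]
    simp only [u₂]
    norm_num [neg_div]
    positivity
  have hconv {p q : ℝ} (hp : p ∈ K) (hq : q ∈ K) (hpq : p ≤ q) : Set.Icc p q ⊆ K := by
    have hcont : ContinuousOn (fun v : ℝ => v ^ σ * q + (1 - v) ^ σ * p) (Set.Icc 0 1) :=
      (((continuous_id.rpow_const fun _ => Or.inr hσ.le).mul continuous_const).add
        (((continuous_const.sub continuous_id).rpow_const fun _ => Or.inr hσ.le).mul
          continuous_const)).continuousOn
    intro z hz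
    have h := intermediate_value_Icc zero_le_one hcont
    simp only [Real.zero_rpow hσ.ne', sub_zero, Real.one_rpow, sub_self, zero_mul, one_mul,
      zero_add, add_zero] at h
    obtain ⟨v, hv, rfl⟩ := h hz
    exact hmix hq hp hv
  -- The dilation obtained from `p = q` and `v = 1/2`; it exceeds one because `σ < 1`.
  set r : ℝ := 2 * (1 / 2 : ℝ) ^ σ with hr
  have hr1 : 1 < r := by
    have : (1 / 2 : ℝ) ^ (1 : ℝ) < (1 / 2 : ℝ) ^ σ :=
      Real.rpow_lt_rpow_of_exponent_gt (by norm_num) (by norm_num) H.sigma_lt_one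
    rw [Real.rpow_one] at this
    linarith
  have hscale {p : ℝ} (hp : p ∈ K) (n : ℕ) : r ^ n * p ∈ K := by
    induction n with
    | zero => simpa using hp
    | succ n ih =>
      have := hmix ih ih (v := 1 / 2) (by norm_num)
      rw [show (1 - 1 / 2 : ℝ) = 1 / 2 by norm_num] at this
      convert this using 1
      rw [hr]
      ring
  rw [Set.eq_univ_iff_forall]
  intro z
  obtain ⟨n, hn⟩ := pow_unbounded_of_one_lt (|z| / p + |z| / -q) hr1
  have hz1 : 0 ≤ |z| / p := by positivity
  have hz2 : 0 ≤ |z| / -q := div_nonneg (abs_nonneg _) (by linarith)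
  have h1 : |z| / p < r ^ n := by linarith
  have h2 : |z| / -q < r ^ n := by linarith
  rw [div_lt_iff₀ hp] at h1
  rw [div_lt_iff₀ (by linarith)] at h2
  have h3 := neg_abs_le z
  have h4 := le_abs_self z
  refine hconv (hscale hqK n) (hscale hpK n) ?_ ⟨?_, ?_⟩ <;> linarith

theorem IsLarge.support_law_black (H : IsLarge a b c d) :
    (law a b c d (0, 1)).support = Set.univ := by
  rw [← H.support_law_red_eq_black, H.support_law_red]

end Support

/-- The characteristic function of a law with full support has modulus less than one. -/
lemma norm_charFun_lt_one_of_support {μ : Measure ℝ} [IsProbabilityMeasure μ]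
    (h : μ.support = Set.univ) {t : ℝ} (ht : t ≠ 0) : ‖charFun μ t‖ < 1 := by
  refine lt_of_le_of_ne (norm_charFun_le_one t) fun h1 => ?_
  set θ := (charFun μ t).arg
  have e1 : charFun μ t = Complex.exp (θ * Complex.I) := by
    rw [← Complex.norm_mul_exp_arg_mul_I (charFun μ t), h1]; simp [θ]
  have hint : Integrable (fun x : ℝ => Complex.exp (((t * x - θ : ℝ) : ℂ) * Complex.I)) μ :=
    Integrable.of_bound (C := 1) (Measurable.aestronglyMeasurable (by fun_prop))
      (ae_of_all _ fun x => by rw [Complex.norm_exp_ofReal_mul_I])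
  have e2 : ∫ x, Complex.exp (((t * x - θ : ℝ) : ℂ) * Complex.I) ∂μ = 1 := by
    have : ∀ x : ℝ, Complex.exp (((t * x - θ : ℝ) : ℂ) * Complex.I) =
        Complex.exp (t * x * Complex.I) * Complex.exp (-(θ * Complex.I)) := fun x => by
      rw [← Complex.exp_add]; push_cast; ring_nf
    simp only [this]
    rw [integral_mul_const, ← charFun_apply_real, e1, ← Complex.exp_add]
    simp
  have e3 : ∫ x, Real.cos (t * x - θ) ∂μ = 1 := by
    have h2 := integral_re hint
    simp only [RCLike.re_eq_complex_re, Complex.exp_ofReal_mul_I_re] at h2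
    rw [h2, e2]
    simp
  have hintc : Integrable (fun x : ℝ => Real.cos (t * x - θ)) μ :=
    Integrable.of_bound (C := 1) (Measurable.aestronglyMeasurable (by fun_prop))
      (ae_of_all _ fun x => by simpa using Real.abs_cos_le_one _)
  have e4 : ∫ x, (1 - Real.cos (t * x - θ)) ∂μ = 0 := by
    rw [integral_sub (integrable_const _) hintc, e3]; simp
  have hint1 : Integrable (fun x : ℝ => 1 - Real.cos (t * x - θ)) μ :=
    (integrable_const _).sub hintc
  rw [integral_eq_zero_iff_of_nonneg (fun x => by simpa using Real.cos_le_one _) hint1] at e4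
  have hcl : IsClosed {x : ℝ | 1 - Real.cos (t * x - θ) = 0} :=
    isClosed_eq (by fun_prop) (by fun_prop)
  have := Measure.support_subset_of_isClosed hcl e4
  rw [h] at this
  -- Modulus one forces `cos (tx - θ) = 1` on the whole support; at this point the cosine is `-1`.
  have h5 : 1 - Real.cos (t * ((θ + Real.pi) / t) - θ) = 0 := this (Set.mem_univ _)
  rw [mul_div_cancel₀ _ ht, add_sub_cancel_left, Real.cos_pi] at h5
  norm_num at h5

/-! ### Decay of the characteristic functions -/

section Deterministic

variable {ν : Measure ℝ} {σ : ℝ}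

lemma tendsto_rpow_mul_atTop {v : ℝ} (hv : 0 < v) (σ : ℝ) :
    Tendsto (fun t : ℝ => v ^ σ * t) atTop atTop :=
  tendsto_id.const_mul_atTop (Real.rpow_pos_of_pos hv σ)

/-- A function bounded by the beta mixture of itself with a function tending to zero decays
polynomially. -/
lemma exists_rpow_bound_of_mixture_le {α β ρ : ℝ} (hα : 0 < α) (hβ : 0 < β) (hρ : 0 < ρ)
    (hρα : 0 < α - σ * ρ) {ψ h : ℝ → ℝ} (hψm : Measurable ψ) (hhm : Measurable h)
    (hψ : ∀ t, 0 ≤ ψ t ∧ ψ t ≤ 1) (hh : ∀ t, 0 ≤ h t ∧ h t ≤ 1)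
    (hlim : Tendsto h atTop (𝓝 0)) (hσ : 0 < σ)
    (hle : ∀ t, 0 < t → ψ t ≤ ∫ v, ψ (v ^ σ * t) * h ((1 - v) ^ σ * t) ∂betaMeasure α β) :
    ∃ C, 0 < C ∧ ∀ t, 0 < t → ψ t ≤ C * t ^ (-ρ) := by
  have hprob := isProbabilityMeasureBeta hα hβ
  have hdom : Integrable (fun v : ℝ => v ^ (-(σ * ρ))) (betaMeasure α β) := by
    have := integrable_rpow_betaMeasure hα hβ (p := -(σ * ρ)) (q := 0) (by linarith) (by linarith)
    simpa using this
  have hbound (t : ℝ) : ∀ᵐ v ∂betaMeasure α β,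
      ‖v ^ (-(σ * ρ)) * h ((1 - v) ^ σ * t)‖ ≤ v ^ (-(σ * ρ)) := by
    filter_upwards [ae_betaMeasure_mem_Ioo α β] with v hv
    have h0 : 0 ≤ v ^ (-(σ * ρ)) := Real.rpow_nonneg hv.1.le _
    rw [Real.norm_of_nonneg (mul_nonneg h0 (hh _).1)]
    exact mul_le_of_le_one_right h0 (hh _).2
  have hE : Tendsto (fun t => ∫ v, v ^ (-(σ * ρ)) * h ((1 - v) ^ σ * t) ∂betaMeasure α β) atTop
      (𝓝 0) := by
    rw [show (0 : ℝ) = ∫ v, (0 : ℝ) ∂betaMeasure α β by simp]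
    refine tendsto_integral_filter_of_dominated_convergence _ ?_
      (Eventually.of_forall hbound) hdom ?_
    · exact Eventually.of_forall fun t => Measurable.aestronglyMeasurable (by fun_prop)
    · filter_upwards [ae_betaMeasure_mem_Ioo α β] with v hv
      have := (hlim.comp (tendsto_rpow_mul_atTop (sub_pos.2 hv.2) σ)).const_mul (v ^ (-(σ * ρ)))
      simpa using this
  obtain ⟨t₀, ht₀⟩ := eventually_atTop.1
      (hE.eventually (ge_mem_nhds (show (0 : ℝ) < 1 / 2 by norm_num)))
  set t₁ := max t₀ 1
  have ht₁ : 0 < t₁ := lt_of_lt_of_le one_pos (le_max_right _ _)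
  refine ⟨t₁ ^ ρ, Real.rpow_pos_of_pos ht₁ ρ, fun T hT => ?_⟩
  -- Truncation at `T` makes the supremum finite a priori, and `v ^ σ * t ≤ t` keeps the mixture
  -- inside the range. The final bound `t₁ ^ ρ` is independent of `T`.
  set A : Set ℝ := (fun t => t ^ ρ * ψ t) '' Set.Ioc 0 T
  have hA : BddAbove A := by
    refine ⟨T ^ ρ, ?_⟩
    rintro _ ⟨t, ht, rfl⟩
    have h1 : t ^ ρ ≤ T ^ ρ := Real.rpow_le_rpow ht.1.le ht.2 hρ.le
    have h2 : 0 ≤ t ^ ρ := Real.rpow_nonneg ht.1.le _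
    exact (mul_le_of_le_one_right h2 (hψ t).2).trans h1
  set K := sSup A
  have hK (t : ℝ) (ht : t ∈ Set.Ioc 0 T) : t ^ ρ * ψ t ≤ K := le_csSup hA ⟨t, ht, rfl⟩
  have hK0 : 0 ≤ K :=
    (mul_nonneg (Real.rpow_nonneg hT.le ρ) (hψ T).1).trans (hK T ⟨hT, le_rfl⟩)
  have hstep : K ≤ max (t₁ ^ ρ) (K / 2) := by
    refine csSup_le ⟨_, T, ⟨hT, le_rfl⟩, rfl⟩ ?_
    rintro _ ⟨t, ht, rfl⟩
    simp only
    rcases le_total t t₁ with htt | htt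
    · refine le_max_of_le_left ?_
      exact (mul_le_of_le_one_right (Real.rpow_nonneg ht.1.le ρ) (hψ t).2).trans
        (Real.rpow_le_rpow ht.1.le htt hρ.le)
    · refine le_max_of_le_right ?_
      have h1 := hle t ht.1
      have h2 := ht₀ t ((le_max_left _ _).trans htt)
      have hi1 : Integrable (fun v => ψ (v ^ σ * t) * h ((1 - v) ^ σ * t)) (betaMeasure α β) := by
        refine Integrable.of_bound (C := 1) (Measurable.aestronglyMeasurable (by fun_prop))
          (ae_of_all _ fun v => ?_)
        rw [Real.norm_of_nonneg (mul_nonneg (hψ _).1 (hh _).1)]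
        exact mul_le_one₀ (hψ _).2 (hh _).1 (hh _).2
      have hi2 : Integrable (fun v => v ^ (-(σ * ρ)) * h ((1 - v) ^ σ * t)) (betaMeasure α β) :=
        hdom.mono' (Measurable.aestronglyMeasurable (by fun_prop)) (hbound t)
      calc t ^ ρ * ψ t
          ≤ t ^ ρ * ∫ v, ψ (v ^ σ * t) * h ((1 - v) ^ σ * t) ∂betaMeasure α β :=
            mul_le_mul_of_nonneg_left h1 (Real.rpow_nonneg ht.1.le ρ)
        _ = ∫ v, t ^ ρ * (ψ (v ^ σ * t) * h ((1 - v) ^ σ * t)) ∂betaMeasure α β :=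
            (integral_const_mul _ _).symm
        _ ≤ ∫ v, K * (v ^ (-(σ * ρ)) * h ((1 - v) ^ σ * t)) ∂betaMeasure α β := by
            refine integral_mono_ae (hi1.const_mul _) (hi2.const_mul _) ?_
            filter_upwards [ae_betaMeasure_mem_Ioo α β] with v hv
            have hvσ : 0 < v ^ σ := Real.rpow_pos_of_pos hv.1 σ
            have hvσ1 : v ^ σ ≤ 1 := Real.rpow_le_one hv.1.le hv.2.le hσ.le
            have h3 := hK (v ^ σ * t) ⟨mul_pos hvσ ht.1,
              (mul_le_of_le_one_left ht.1.le hvσ1).trans ht.2⟩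
            rw [Real.mul_rpow hvσ.le ht.1.le, ← Real.rpow_mul hv.1.le] at h3
            rw [Real.rpow_neg hv.1.le, ← mul_assoc, ← mul_assoc]
            refine mul_le_mul_of_nonneg_right ?_ (hh _).1
            rw [← div_eq_mul_inv, le_div_iff₀ (Real.rpow_pos_of_pos hv.1 _)]
            linarith
        _ = K * ∫ v, v ^ (-(σ * ρ)) * h ((1 - v) ^ σ * t) ∂betaMeasure α β :=
            integral_const_mul _ _
        _ ≤ K / 2 := by nlinarith
  have hfin : K ≤ t₁ ^ ρ := by
    rcases le_max_iff.1 hstep with h | h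
    · exact h
    · have : K ≤ 0 := by linarith
      exact this.trans (Real.rpow_nonneg ht₁.le ρ)
  have := (hK T ⟨hT, le_rfl⟩).trans hfin
  rw [Real.rpow_neg hT.le, ← div_eq_mul_inv, le_div_iff₀ (Real.rpow_pos_of_pos hT ρ)]
  linarith

/-- Polynomial decay rates add up under beta mixtures. -/
lemma rpow_bound_of_mixture_le {α β p q C D : ℝ} (hα : 0 < α) (hβ : 0 < β)
    (hp : 0 < α - σ * p) (hq : 0 < β - σ * q) {φ ψ h : ℝ → ℝ} (hC : 0 < C) (hD : 0 < D)
    (hψ : ∀ t, 0 < t → 0 ≤ ψ t ∧ ψ t ≤ C * t ^ (-p))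
    (hh : ∀ t, 0 < t → 0 ≤ h t ∧ h t ≤ D * t ^ (-q))
    (hψm : Measurable ψ) (hhm : Measurable h)
    (hle : ∀ t, 0 < t → φ t ≤ ∫ v, ψ (v ^ σ * t) * h ((1 - v) ^ σ * t) ∂betaMeasure α β) :
    ∃ E, 0 < E ∧ ∀ t, 0 < t → φ t ≤ E * t ^ (-(p + q)) := by
  have hI := integral_rpow_betaMeasure hα hβ (p := -(σ * p)) (q := -(σ * q))
    (by linarith) (by linarith)
  have hint := integrable_rpow_betaMeasure hα hβ (p := -(σ * p)) (q := -(σ * q))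
    (by linarith) (by linarith)
  have hpos : 0 < beta (α + -(σ * p)) (β + -(σ * q)) / beta α β :=
    div_pos (beta_pos (by linarith) (by linarith)) (beta_pos hα hβ)
  refine ⟨C * D * (beta (α + -(σ * p)) (β + -(σ * q)) / beta α β), by positivity, fun t ht => ?_⟩
  have hbd : ∀ᵐ v ∂betaMeasure α β, ψ (v ^ σ * t) * h ((1 - v) ^ σ * t) ≤
      C * D * t ^ (-(p + q)) * (v ^ (-(σ * p)) * (1 - v) ^ (-(σ * q))) ∧
      0 ≤ ψ (v ^ σ * t) * h ((1 - v) ^ σ * t) := by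
    filter_upwards [ae_betaMeasure_mem_Ioo α β] with v hv
    have hv' : 0 < 1 - v := sub_pos.2 hv.2
    have h1 := hψ (v ^ σ * t) (mul_pos (Real.rpow_pos_of_pos hv.1 σ) ht)
    have h2 := hh ((1 - v) ^ σ * t) (mul_pos (Real.rpow_pos_of_pos hv' σ) ht)
    refine ⟨(mul_le_mul h1.2 h2.2 h2.1 (h1.1.trans h1.2)).trans_eq ?_, mul_nonneg h1.1 h2.1⟩
    rw [Real.mul_rpow (Real.rpow_nonneg hv.1.le _) ht.le, Real.mul_rpow
      (Real.rpow_nonneg hv'.le _) ht.le, ← Real.rpow_mul hv.1.le, ← Real.rpow_mul hv'.le,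
      neg_add, Real.rpow_add ht, mul_neg, mul_neg]
    ring
  calc φ t ≤ ∫ v, ψ (v ^ σ * t) * h ((1 - v) ^ σ * t) ∂betaMeasure α β := hle t ht
    _ ≤ ∫ v, C * D * t ^ (-(p + q)) * (v ^ (-(σ * p)) * (1 - v) ^ (-(σ * q))) ∂betaMeasure α β := by
        have hi2 := hint.const_mul (C * D * t ^ (-(p + q)))
        refine integral_mono_ae (hi2.mono' (Measurable.aestronglyMeasurable (by fun_prop)) ?_)
          hi2 (hbd.mono fun v hv => hv.1)
        filter_upwards [hbd] with v hv
        rw [Real.norm_of_nonneg hv.2]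
        exact hv.1
    _ = _ := by
        rw [integral_const_mul, hI]
        ring

/-- Vanishing at infinity passes to beta mixtures. -/
lemma tendsto_zero_of_mixture_le {α β : ℝ} (hα : 0 < α) (hβ : 0 < β) {φ ψ h : ℝ → ℝ}
    (hψm : Measurable ψ) (hhm : Measurable h) (hφ : ∀ t, 0 ≤ φ t)
    (hψ : ∀ t, 0 ≤ ψ t ∧ ψ t ≤ 1) (hh : ∀ t, 0 ≤ h t ∧ h t ≤ 1)
    (hlim : Tendsto ψ atTop (𝓝 0))
    (hle : ∀ t, φ t ≤ ∫ v, ψ (v ^ σ * t) * h ((1 - v) ^ σ * t) ∂betaMeasure α β) :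
    Tendsto φ atTop (𝓝 0) := by
  have hprob := isProbabilityMeasureBeta hα hβ
  refine squeeze_zero hφ hle ?_
  rw [show (0 : ℝ) = ∫ v, (0 : ℝ) ∂betaMeasure α β by simp]
  refine tendsto_integral_filter_of_dominated_convergence (fun _ => 1) ?_ ?_
    (integrable_const _) ?_
  · exact Eventually.of_forall fun t => Measurable.aestronglyMeasurable (by fun_prop)
  · refine Eventually.of_forall fun t => ae_of_all _ fun v => ?_
    rw [Real.norm_of_nonneg (mul_nonneg (hψ _).1 (hh _).1)]
    exact mul_le_one₀ (hψ _).2 (hh _).1 (hh _).2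
  · filter_upwards [ae_betaMeasure_mem_Ioo α β] with v hv
    refine squeeze_zero (fun t => mul_nonneg (hψ _).1 (hh _).1)
      (fun t => mul_le_of_le_one_right (hψ _).1 (hh _).2) ?_
    exact hlim.comp (tendsto_rpow_mul_atTop hv.1 σ)

/-- A function bounded by the beta mixture of itself with a function that stays below some `q < 1`
vanishes at infinity. -/
lemma tendsto_zero_of_mixture_le_self {α β q : ℝ} (hα : 0 < α) (hβ : 0 < β) (hq : q < 1)
    {ψ h : ℝ → ℝ} (hψm : Measurable ψ) (hhm : Measurable h)
    (hψ : ∀ t, 0 ≤ ψ t ∧ ψ t ≤ 1)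
    (hh : ∀ t, 0 ≤ h t ∧ h t ≤ 1) (hhq : ∀ᶠ t in atTop, h t ≤ q)
    (hle : ∀ t, 0 < t → ψ t ≤ ∫ v, ψ (v ^ σ * t) * h ((1 - v) ^ σ * t) ∂betaMeasure α β) :
    Tendsto ψ atTop (𝓝 0) := by
  have hprob := isProbabilityMeasureBeta hα hβ
  -- The decreasing envelope converges to `L`, the limit superior of `ψ`, and inherits the mixture
  -- inequality.
  set g : ℝ → ℝ := fun t => ⨆ s : Set.Ici t, ψ s
  have hbdd (t : ℝ) : BddAbove (Set.range fun s : Set.Ici t => ψ s) :=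
    ⟨1, by rintro _ ⟨s, rfl⟩; exact (hψ _).2⟩
  have hψg {s t : ℝ} (hst : t ≤ s) : ψ s ≤ g t := le_ciSup (hbdd t) ⟨s, hst⟩
  have hg0 (t : ℝ) : 0 ≤ g t := (hψ t).1.trans (hψg le_rfl)
  have hg1 (t : ℝ) : g t ≤ 1 := ciSup_le fun s => (hψ s).2
  have hganti : Antitone g := fun s t hst =>
    ciSup_le fun u => hψg (hst.trans u.2)
  have hgm : Measurable g := hganti.measurable
  have hgbdd : BddBelow (Set.range g) := ⟨0, by rintro _ ⟨s, rfl⟩; exact hg0 s⟩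
  set L := ⨅ t, g t
  have hgL : Tendsto g atTop (𝓝 L) := tendsto_atTop_ciInf hganti hgbdd
  have hL0 : 0 ≤ L := le_ciInf hg0
  obtain ⟨s₀, hs₀⟩ := eventually_atTop.1 hhq
  -- An antitone majorant of `h`: at any `s ≥ t` the integrand is then dominated by its value at
  -- `t`.
  set h' : ℝ → ℝ := fun s => if s₀ ≤ s then q else 1
  have hh'm : Measurable h' :=
    Measurable.ite measurableSet_Ici measurable_const measurable_const
  have hhh' (s : ℝ) : h s ≤ h' s := by
    simp only [h']; split_ifs with hs
    · exact hs₀ s hs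
    · exact (hh s).2
  have hh'0 (s : ℝ) : 0 ≤ h' s := (hh s).1.trans (hhh' s)
  have hh'1 (s : ℝ) : h' s ≤ 1 := by
    simp only [h']; split_ifs
    · exact hq.le
    · exact le_rfl
  have hh'anti : Antitone h' := by
    intro s t hst
    simp only [h']
    split_ifs with h1 h2
    · exact le_rfl
    · exact hq.le
    · exact absurd (‹s₀ ≤ s›.trans hst) h1
    · exact le_rfl
  have hint (t : ℝ) : Integrable (fun v => g (v ^ σ * t) * h' ((1 - v) ^ σ * t))
      (betaMeasure α β) := by
    refine Integrable.of_bound (C := 1) (Measurable.aestronglyMeasurable (by fun_prop))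
      (ae_of_all _ fun v => ?_)
    rw [Real.norm_of_nonneg (mul_nonneg (hg0 _) (hh'0 _))]
    exact mul_le_one₀ (hg1 _) (hh'0 _) (hh'1 _)
  have hgle (t : ℝ) (ht : 0 < t) :
      g t ≤ ∫ v, g (v ^ σ * t) * h' ((1 - v) ^ σ * t) ∂betaMeasure α β := by
    refine ciSup_le fun s => (hle s (ht.trans_le s.2)).trans ?_
    refine integral_mono_ae ?_ (hint t) ?_
    · refine Integrable.of_bound (C := 1) (Measurable.aestronglyMeasurable (by fun_prop))
        (ae_of_all _ fun v => ?_)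
      rw [Real.norm_of_nonneg (mul_nonneg (hψ _).1 (hh _).1)]
      exact mul_le_one₀ (hψ _).2 (hh _).1 (hh _).2
    · filter_upwards [ae_betaMeasure_mem_Ioo α β] with v hv
      have h1 : v ^ σ * t ≤ v ^ σ * s := mul_le_mul_of_nonneg_left s.2 (Real.rpow_nonneg hv.1.le σ)
      have h2 : (1 - v) ^ σ * t ≤ (1 - v) ^ σ * s :=
        mul_le_mul_of_nonneg_left s.2 (Real.rpow_nonneg (sub_pos.2 hv.2).le σ)
      exact mul_le_mul (hψg h1) ((hhh' _).trans (hh'anti h2)) (hh _).1 (hg0 _)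
  have hlim : Tendsto (fun t => ∫ v, g (v ^ σ * t) * h' ((1 - v) ^ σ * t) ∂betaMeasure α β) atTop
      (𝓝 (L * q)) := by
    rw [show L * q = ∫ v, L * q ∂betaMeasure α β by simp]
    refine tendsto_integral_filter_of_dominated_convergence (fun _ => 1) ?_ ?_
      (integrable_const _) ?_
    · exact Eventually.of_forall fun t => (hint t).aestronglyMeasurable
    · refine Eventually.of_forall fun t => ae_of_all _ fun v => ?_
      rw [Real.norm_of_nonneg (mul_nonneg (hg0 _) (hh'0 _))]
      exact mul_le_one₀ (hg1 _) (hh'0 _) (hh'1 _)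
    · filter_upwards [ae_betaMeasure_mem_Ioo α β] with v hv
      refine (hgL.comp (tendsto_rpow_mul_atTop hv.1 σ)).mul ?_
      refine tendsto_const_nhds.congr' ?_
      filter_upwards [(tendsto_rpow_mul_atTop (sub_pos.2 hv.2) σ).eventually_ge_atTop s₀] with t ht
      simp only [h', if_pos ht]
  have hLq : L ≤ L * q :=
    le_of_tendsto_of_tendsto hgL hlim ((eventually_gt_atTop 0).mono fun t ht => hgle t ht)
  have hL : L = 0 := by nlinarith
  rw [hL] at hgL
  exact squeeze_zero (fun t => (hψ t).1) (fun t => hψg le_rfl) hgL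

end Deterministic

/-! ### Decay of the limit characteristic functions of the urn -/

section Urn

variable {a b c d : ℕ}

/-- The modulus of the characteristic function of the limit law. -/
noncomputable def absCharFun (a b c d : ℕ) (x : ℕ × ℕ) (t : ℝ) : ℝ := ‖charFun (law a b c d x) t‖

namespace IsLarge

lemma absCharFun_mem (H : IsLarge a b c d) (x : ℕ × ℕ) (t : ℝ) :
    0 ≤ absCharFun a b c d x t ∧ absCharFun a b c d x t ≤ 1 := by
  have := H.isProbabilityMeasure_law x
  exact ⟨norm_nonneg _, norm_charFun_le_one _⟩

lemma continuous_absCharFun (H : IsLarge a b c d) (x : ℕ × ℕ) : Continuous (absCharFun a b c d x)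
    := by
  have := H.isProbabilityMeasure_law x
  exact (continuous_charFun).norm

lemma absCharFun_add_le (H : IsLarge a b c d) {x y : ℕ × ℕ} (hx : x ≠ 0) (hy : y ≠ 0) (t : ℝ) :
    absCharFun a b c d (x + y) t ≤ ∫ v, absCharFun a b c d x (v ^ sigma a b c * t) *
      absCharFun a b c d y ((1 - v) ^ sigma a b c * t)
        ∂betaMeasure ((x.1 + x.2 : ℝ) / (a + b)) ((y.1 + y.2 : ℝ) / (a + b)) := by
  rw [absCharFun, H.charFun_law_add hx hy]
  refine (norm_integral_le_integral_norm _).trans_eq ?_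
  simp only [norm_mul, absCharFun]

lemma shape_pos (H : IsLarge a b c d) {x : ℕ × ℕ} (hx : x ≠ 0) : (0 : ℝ) < (x.1 + x.2 : ℝ)
    / (a + b) :=
  div_pos (cast_total_pos hx) H.cast_pos

/-- If both one-ball characteristic functions are bounded by `q` on `[1, τ)`, then so are all
others, from some point on. -/
lemma absCharFun_le_of_ball (H : IsLarge a b c d) {q τ : ℝ}
    (h1 : ∀ t, 1 ≤ t → t < τ → absCharFun a b c d (1, 0) t ≤ q)
    (h2 : ∀ t, 1 ≤ t → t < τ → absCharFun a b c d (0, 1) t ≤ q) (n : ℕ) {x : ℕ × ℕ}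
    (hx : x.1 + x.2 = n + 1) {t : ℝ} (ht : ((n + 1 : ℕ) : ℝ) ^ sigma a b c ≤ t) (htτ : t < τ) :
    absCharFun a b c d x t ≤ q := by
  have hσ := H.sigma_pos
  induction n generalizing x t with
  | zero =>
    simp only [zero_add, Nat.cast_one, Real.one_rpow] at ht
    obtain ⟨x1, x2⟩ := x
    simp only at hx
    rcases Nat.eq_zero_or_pos x1 with h | h
    · obtain rfl := h
      obtain rfl : x2 = 1 := by omega
      exact h2 t ht htτ
    · obtain rfl : x1 = 1 := by omega
      obtain rfl : x2 = 0 := by omega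
      exact h1 t ht htτ
  | succ n ih =>
    obtain ⟨e, y, rfl, he, hey, hy⟩ : ∃ e y : ℕ × ℕ, e + y = x ∧ e ≠ 0 ∧
        (∀ t, 1 ≤ t → t < τ → absCharFun a b c d e t ≤ q) ∧ y.1 + y.2 = n + 1 := by
      obtain ⟨x1, x2⟩ := x
      simp only at hx
      rcases Nat.eq_zero_or_pos x1 with h | h
      · obtain rfl := h
        exact ⟨(0, 1), (0, n + 1), by simp only [Prod.mk_add_mk]; congr 1; omega, by simp, h2,
          by simp⟩
      · exact ⟨(1, 0), (x1 - 1, x2), by simp only [Prod.mk_add_mk]; congr 1 <;> omega, by simp, h1,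
          by simp only; omega⟩
    have hy0 : y ≠ 0 := fun h => by rw [h] at hy; simp at hy
    have hprob := isProbabilityMeasureBeta (H.shape_pos he) (H.shape_pos hy0)
    have hc1 := (H.continuous_absCharFun e).measurable
    have hc2 := (H.continuous_absCharFun y).measurable
    have ht0 : 0 < t := lt_of_lt_of_le (by positivity) ht
    refine (H.absCharFun_add_le he hy0 t).trans ?_
    have hint : Integrable (fun v => absCharFun a b c d e (v ^ sigma a b c * t) *
        absCharFun a b c d y ((1 - v) ^ sigma a b c * t))
        (betaMeasure ((e.1 + e.2 : ℝ) / (a + b)) ((y.1 + y.2 : ℝ) / (a + b))) := by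
      refine Integrable.of_bound (C := 1) (Measurable.aestronglyMeasurable (by fun_prop))
        (ae_of_all _ fun v => ?_)
      rw [Real.norm_of_nonneg (mul_nonneg (H.absCharFun_mem _ _).1 (H.absCharFun_mem _ _).1)]
      exact mul_le_one₀ (H.absCharFun_mem _ _).2 (H.absCharFun_mem _ _).1 (H.absCharFun_mem _ _).2
    refine (integral_mono_ae hint (integrable_const q) ?_).trans_eq (by simp)
    filter_upwards [ae_betaMeasure_mem_Ioo _ _] with v hv
    have hn2 : (0 : ℝ) < ((n + 1 + 1 : ℕ) : ℝ) := by positivity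
    have hscale {w k : ℝ} (hw : 0 < w) (hw1 : w < 1) (hk : 0 ≤ k)
        (hkw : k ≤ w * ((n + 1 + 1 : ℕ) : ℝ)) :
        k ^ sigma a b c ≤ w ^ sigma a b c * t ∧ w ^ sigma a b c * t < τ := by
      refine ⟨?_, ?_⟩
      · calc k ^ sigma a b c ≤ (w * ((n + 1 + 1 : ℕ) : ℝ)) ^ sigma a b c :=
              Real.rpow_le_rpow hk hkw hσ.le
          _ = w ^ sigma a b c * ((n + 1 + 1 : ℕ) : ℝ) ^ sigma a b c :=
              Real.mul_rpow hw.le hn2.le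
          _ ≤ _ := mul_le_mul_of_nonneg_left ht (Real.rpow_nonneg hw.le _)
      · exact (mul_le_of_le_one_left ht0.le (Real.rpow_le_one hw.le hw1.le hσ.le)).trans_lt htτ
    -- With `n + 2` balls, either `v ≥ 1/(n+2)` and the single ball is in its range, or `1 - v ≥
    -- (n+1)/(n+2)` and the other `n + 1` balls are in theirs. The other factor is bounded by one.
    rcases le_total (1 / ((n + 1 + 1 : ℕ) : ℝ)) v with hvn | hvn
    · rw [div_le_iff₀ hn2] at hvn
      obtain ⟨h3, h4⟩ := hscale hv.1 hv.2 zero_le_one hvn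
      rw [Real.one_rpow] at h3
      exact (mul_le_of_le_one_right (H.absCharFun_mem _ _).1 (H.absCharFun_mem _ _).2).trans
        (hey _ h3 h4)
    · rw [le_div_iff₀ hn2] at hvn
      obtain ⟨h3, h4⟩ := hscale (w := 1 - v) (k := ((n + 1 : ℕ) : ℝ)) (sub_pos.2 hv.2)
        (by linarith [hv.1]) (by positivity) (by rw [sub_mul]; push_cast at hvn ⊢; linarith)
      exact (mul_le_of_le_one_left (H.absCharFun_mem _ _).1 (H.absCharFun_mem _ _).2).trans
        (ih hy h3 h4)

lemma law_ball (H : IsLarge a b c d) {e : ℕ × ℕ} (he : e = (1, 0) ∨ e = (0, 1)) :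
    ∃ w : ℕ × ℕ, w.1 + w.2 = a + b ∧ law a b c d e = law a b c d (e + w) := by
  rcases he with rfl | rfl
  · exact ⟨(a, b), rfl, by rw [H.law_red]; simp [add_comm]⟩
  · exact ⟨(c, d), H.balance.symm, by rw [H.law_black]; simp [add_comm]⟩

/-- Strict improvement of a common bound `q` at the end of an interval. -/
lemma absCharFun_ball_lt (H : IsLarge a b c d) {q τ : ℝ} (hq0 : 0 < q) (hq1 : q < 1)
    (hτ : ((a + b + 2 : ℕ) : ℝ) ^ sigma a b c ≤ τ)
    (h1 : ∀ t, 1 ≤ t → t < τ → absCharFun a b c d (1, 0) t ≤ q)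
    (h2 : ∀ t, 1 ≤ t → t < τ → absCharFun a b c d (0, 1) t ≤ q) {e : ℕ × ℕ}
    (he : e = (1, 0) ∨ e = (0, 1)) : absCharFun a b c d e τ < q := by
  have hσ := H.sigma_pos
  have hS := H.total_pos
  have hS' := H.cast_pos
  obtain ⟨w, hw, hlaw⟩ := H.law_ball he
  have he0 : e ≠ 0 := by rcases he with rfl | rfl <;> simp
  have hw0 : w ≠ 0 := fun h => by rw [h] at hw; simp at hw; omega
  have hprob := isProbabilityMeasureBeta (H.shape_pos he0) (H.shape_pos hw0)
  have hc1 := (H.continuous_absCharFun e).measurable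
  have hc2 := (H.continuous_absCharFun w).measurable
  have hτ0 : 0 < τ := lt_of_lt_of_le (by positivity) hτ
  have hlt : absCharFun a b c d e τ = absCharFun a b c d (e + w) τ := by
    rw [absCharFun, absCharFun, hlaw]
  rw [hlt]
  refine (H.absCharFun_add_le he0 hw0 τ).trans_lt ?_
  set ν := betaMeasure ((e.1 + e.2 : ℝ) / (a + b)) ((w.1 + w.2 : ℝ) / (a + b))
  -- With `N = S + 2`, the single ball is in range when `vN ≥ 1` and the other `S` balls when `vN ≤
  -- 2`. These cases cover everything and overlap on an interval of positive mass, where the product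
  -- is at most `q² < q`.
  set N : ℝ := ((a + b + 2 : ℕ) : ℝ) with hN
  have hN2 : 2 < N := by
    rw [hN]; push_cast; linarith
  have hNpos : 0 < N := by linarith
  set I := Set.Ioo (1 / N) (2 / N)
  have hI : 0 < ν.real I := by
    refine ENNReal.toReal_pos (betaMeasure_Ioo_pos (H.shape_pos he0) (H.shape_pos hw0)
      (by positivity) ?_ ?_).ne' (measure_ne_top _ _)
    · rw [div_le_one hNpos]; exact hN2.le
    · exact div_lt_div_of_pos_right one_lt_two hNpos
  have hint : Integrable (fun v => absCharFun a b c d e (v ^ sigma a b c * τ) *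
      absCharFun a b c d w ((1 - v) ^ sigma a b c * τ)) ν := by
    refine Integrable.of_bound (C := 1) (Measurable.aestronglyMeasurable (by fun_prop))
      (ae_of_all _ fun v => ?_)
    rw [Real.norm_of_nonneg (mul_nonneg (H.absCharFun_mem _ _).1 (H.absCharFun_mem _ _).1)]
    exact mul_le_one₀ (H.absCharFun_mem _ _).2 (H.absCharFun_mem _ _).1 (H.absCharFun_mem _ _).2
  have hind : Integrable (I.indicator fun _ => q - q * q) ν :=
    (integrable_const _).indicator measurableSet_Ioo
  have hball {t : ℝ} (h3 : 1 ≤ t) (h4 : t < τ) : absCharFun a b c d e t ≤ q := by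
    rcases he with rfl | rfl
    · exact h1 t h3 h4
    · exact h2 t h3 h4
  have hrest {t : ℝ} (h3 : ((a + b : ℕ) : ℝ) ^ sigma a b c ≤ t) (h4 : t < τ) :
      absCharFun a b c d w t ≤ q := by
    have hn : a + b - 1 + 1 = a + b := by omega
    refine H.absCharFun_le_of_ball h1 h2 (a + b - 1) (by rw [hn, hw]) ?_ h4
    rwa [hn]
  have hscale {u k : ℝ} (hu : 0 < u) (hu1 : u < 1) (hk : 0 ≤ k) (hku : k ≤ u * N) :
      k ^ sigma a b c ≤ u ^ sigma a b c * τ ∧ u ^ sigma a b c * τ < τ := by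
    refine ⟨?_, mul_lt_of_lt_one_left hτ0 (Real.rpow_lt_one hu.le hu1 hσ)⟩
    calc k ^ sigma a b c ≤ (u * N) ^ sigma a b c := Real.rpow_le_rpow hk hku hσ.le
      _ = u ^ sigma a b c * N ^ sigma a b c := Real.mul_rpow hu.le hNpos.le
      _ ≤ _ := mul_le_mul_of_nonneg_left hτ (Real.rpow_nonneg hu.le _)
  have hNab : N = ((a + b : ℕ) : ℝ) + 2 := by rw [hN]; push_cast; ring
  have hab0 : (0 : ℝ) ≤ ((a + b : ℕ) : ℝ) := by positivity
  calc _ ≤ ∫ v, (q - I.indicator (fun _ => q - q * q) v) ∂ν := by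
        refine integral_mono_ae hint ((integrable_const q).sub hind) ?_
        filter_upwards [ae_betaMeasure_mem_Ioo _ _] with v hv
        have hA : 1 ≤ v * N → absCharFun a b c d e (v ^ sigma a b c * τ) ≤ q := fun h => by
          obtain ⟨h3, h4⟩ := hscale hv.1 hv.2 zero_le_one h
          rw [Real.one_rpow] at h3
          exact hball h3 h4
        have hB : v * N ≤ 2 → absCharFun a b c d w ((1 - v) ^ sigma a b c * τ) ≤ q := fun h => by
          obtain ⟨h3, h4⟩ := hscale (u := 1 - v) (sub_pos.2 hv.2) (by linarith [hv.1]) hab0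
            (by rw [sub_mul]; linarith)
          exact hrest h3 h4
        by_cases hvI : v ∈ I
        · rw [Set.indicator_of_mem hvI]
          have h3 := (div_lt_iff₀ hNpos).1 hvI.1
          have h4 := (lt_div_iff₀ hNpos).1 hvI.2
          have := mul_le_mul (hA h3.le) (hB h4.le) (H.absCharFun_mem _ _).1 hq0.le
          simpa using this
        · rw [Set.indicator_of_notMem hvI, sub_zero]
          rcases le_total 1 (v * N) with h | h
          · exact (mul_le_of_le_one_right (H.absCharFun_mem _ _).1
              (H.absCharFun_mem _ _).2).trans (hA h)
          · exact (mul_le_of_le_one_left (H.absCharFun_mem _ _).1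
              (H.absCharFun_mem _ _).2).trans (hB (by linarith))
    _ = q - ν.real I * (q - q * q) := by
        rw [integral_sub (integrable_const q) hind, integral_indicator_const _ measurableSet_Ioo]
        simp [I]
    _ < q := by nlinarith [mul_pos hI (mul_pos hq0 (sub_pos.2 hq1))]

/-- The maximum over the compact interval `[1, (S+2) ^ σ]` is below one; take `q` between it and
one. A first later time at which `q` is reached would contradict the strict improvement
`absCharFun_ball_lt`. -/
lemma exists_absCharFun_ball_le (H : IsLarge a b c d) : ∃ q : ℝ, 0 < q ∧ q < 1 ∧
    ∀ e : ℕ × ℕ, e = (1, 0) ∨ e = (0, 1) → ∀ t, 1 ≤ t → absCharFun a b c d e t ≤ q := by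
  have hσ := H.sigma_pos
  have hprob1 := H.isProbabilityMeasure_law (1, 0)
  have hprob2 := H.isProbabilityMeasure_law (0, 1)
  have hc1 := H.continuous_absCharFun (1, 0)
  have hc2 := H.continuous_absCharFun (0, 1)
  set M : ℝ → ℝ := fun t => max (absCharFun a b c d (1, 0) t) (absCharFun a b c d (0, 1) t)
  have hM : Continuous M := hc1.max hc2
  set R : ℝ := ((a + b + 2 : ℕ) : ℝ) ^ sigma a b c
  have hR : 1 ≤ R := Real.one_le_rpow (by push_cast; linarith [H.cast_pos]) hσ.le
  obtain ⟨t₀, ht₀, hmax⟩ := isCompact_Icc.exists_isMaxOn (Set.nonempty_Icc.2 hR) hM.continuousOn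
  have hMt₀ : M t₀ < 1 := by
    have ht₀' : t₀ ≠ 0 := by linarith [ht₀.1]
    exact max_lt (norm_charFun_lt_one_of_support H.support_law_red ht₀')
      (norm_charFun_lt_one_of_support H.support_law_black ht₀')
  have hMt₀0 : 0 ≤ M t₀ := (H.absCharFun_mem _ _).1.trans (le_max_left _ _)
  obtain ⟨q, hq, hq1⟩ := exists_between hMt₀
  have hq0 : 0 < q := hMt₀0.trans_lt hq
  refine ⟨q, hq0, hq1, ?_⟩
  suffices h : ∀ t, 1 ≤ t → M t < q by
    rintro e (rfl | rfl) t ht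
    · exact ((le_max_left _ _).trans_lt (h t ht)).le
    · exact ((le_max_right _ _).trans_lt (h t ht)).le
  by_contra! hbad
  set B : Set ℝ := {t | R ≤ t} ∩ {t | q ≤ M t}
  have hB : IsClosed B := isClosed_Ici.inter (isClosed_le continuous_const hM)
  have hBne : B.Nonempty := by
    obtain ⟨t, ht, htq⟩ := hbad
    refine ⟨t, ?_, htq⟩
    by_contra hlt
    exact (hq.trans_le htq).not_ge (hmax ⟨ht, (not_le.1 hlt).le⟩)
  have hBbdd : BddBelow B := ⟨R, fun t ht => ht.1⟩
  obtain ⟨hτR, hτq⟩ := hB.csInf_mem hBne hBbdd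
  set τ := sInf B
  have hbefore (t : ℝ) (h1 : 1 ≤ t) (h2 : t < τ) : M t ≤ q := by
    by_contra! hlt
    rcases le_total t R with h | h
    · exact (hq.trans hlt).not_ge (hmax ⟨h1, h⟩)
    · exact h2.not_ge (csInf_le hBbdd ⟨h, hlt.le⟩)
  have h1 t (h : 1 ≤ t) (h' : t < τ) : absCharFun a b c d (1, 0) t ≤ q :=
    (le_max_left _ _).trans (hbefore t h h')
  have h2 t (h : 1 ≤ t) (h' : t < τ) : absCharFun a b c d (0, 1) t ≤ q :=
    (le_max_right _ _).trans (hbefore t h h')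
  exact (max_lt (H.absCharFun_ball_lt hq0 hq1 hτR h1 h2 (Or.inl rfl))
    (H.absCharFun_ball_lt hq0 hq1 hτR h1 h2 (Or.inr rfl))).not_ge hτq

lemma tendsto_absCharFun_ball (H : IsLarge a b c d) {e : ℕ × ℕ} (he : e = (1, 0) ∨ e = (0, 1)) :
    Tendsto (absCharFun a b c d e) atTop (𝓝 0) := by
  obtain ⟨q, hq0, hq1, hq⟩ := H.exists_absCharFun_ball_le
  obtain ⟨w, hw, hlaw⟩ := H.law_ball he
  have hS := H.total_pos
  have he0 : e ≠ 0 := by rcases he with rfl | rfl <;> simp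
  have hw0 : w ≠ 0 := fun h => by rw [h] at hw; simp at hw; omega
  refine tendsto_zero_of_mixture_le_self (σ := sigma a b c) (H.shape_pos he0) (H.shape_pos hw0) hq1
    (H.continuous_absCharFun e).measurable (H.continuous_absCharFun w).measurable
    (H.absCharFun_mem e) (H.absCharFun_mem w) ?_ fun t _ => ?_
  · filter_upwards [eventually_ge_atTop (((a + b - 1 + 1 : ℕ) : ℝ) ^ sigma a b c)] with t ht
    -- The bound `q` now holds on all of `[1, ∞)`, so any `τ > t` will do.
    exact H.absCharFun_le_of_ball (τ := t + 1) (fun s hs _ => hq _ (Or.inl rfl) s hs)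
      (fun s hs _ => hq _ (Or.inr rfl) s hs) (a + b - 1) (by omega) ht (lt_add_one t)
  · have : absCharFun a b c d e t = absCharFun a b c d (e + w) t := by
      rw [absCharFun, absCharFun, hlaw]
    rw [this]
    exact H.absCharFun_add_le he0 hw0 t

/-- A nonempty composition contains a ball, and its vanishing factor suffices in the mixture. -/
lemma tendsto_absCharFun (H : IsLarge a b c d) {x : ℕ × ℕ} (hx : x ≠ 0) :
    Tendsto (absCharFun a b c d x) atTop (𝓝 0) := by
  obtain ⟨e, y, rfl, he⟩ : ∃ e y : ℕ × ℕ, e + y = x ∧ (e = (1, 0) ∨ e = (0, 1)) := by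
    obtain ⟨x1, x2⟩ := x
    rcases Nat.eq_zero_or_pos x1 with h | h
    · obtain rfl := h
      have : x2 ≠ 0 := fun h => hx (by rw [h]; rfl)
      exact ⟨(0, 1), (0, x2 - 1), by simp only [Prod.mk_add_mk]; congr 1; omega, Or.inr rfl⟩
    · exact ⟨(1, 0), (x1 - 1, x2), by simp only [Prod.mk_add_mk]; congr 1 <;> omega, Or.inl rfl⟩
  have he0 : e ≠ 0 := by rcases he with rfl | rfl <;> simp
  by_cases hy : y = 0
  · rw [hy, add_zero]
    exact H.tendsto_absCharFun_ball he
  · exact tendsto_zero_of_mixture_le (H.shape_pos he0) (H.shape_pos hy)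
      (H.continuous_absCharFun e).measurable (H.continuous_absCharFun y).measurable
      (fun t => (H.absCharFun_mem _ t).1) (H.absCharFun_mem e) (H.absCharFun_mem y)
      (H.tendsto_absCharFun_ball he) (H.absCharFun_add_le he0 hy)

/-- The ball carries the beta parameter `1/S`, and `σρ < 1/S` is exactly `ρ < 1/m`. -/
lemma exists_rpow_bound_ball (H : IsLarge a b c d) {e : ℕ × ℕ} (he : e = (1, 0) ∨ e = (0, 1))
    {ρ : ℝ} (hρ : 0 < ρ)
    (hρm : ρ < 1 / eigm a c) :
    ∃ C, 0 < C ∧ ∀ t, 0 < t → absCharFun a b c d e t ≤ C * t ^ (-ρ) := by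
  obtain ⟨w, hw, hlaw⟩ := H.law_ball he
  have hS := H.total_pos
  have he0 : e ≠ 0 := by rcases he with rfl | rfl <;> simp
  have hw0 : w ≠ 0 := fun h => by rw [h] at hw; simp at hw; omega
  refine exists_rpow_bound_of_mixture_le (H.shape_pos he0) (H.shape_pos hw0) hρ ?_
    (H.continuous_absCharFun e).measurable (H.continuous_absCharFun w).measurable
    (H.absCharFun_mem e) (H.absCharFun_mem w) (H.tendsto_absCharFun hw0) H.sigma_pos fun t _ => ?_
  · have h1 : (e.1 : ℝ) + e.2 = 1 := by rcases he with rfl | rfl <;> simp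
    have hS' := H.cast_pos
    rw [h1, sub_pos, lt_div_iff₀ hS']
    rw [lt_div_iff₀ H.eigm_pos, H.eigm_eq] at hρm
    linarith
  · have : absCharFun a b c d e t = absCharFun a b c d (e + w) t := by
      rw [absCharFun, absCharFun, hlaw]
    rw [this]
    exact H.absCharFun_add_le he0 hw0 t

/-- Adding balls one at a time adds rates; integrability persists because both the beta parameter
and the rate are proportional to the number of balls. -/
lemma exists_rpow_bound_nsmul (H : IsLarge a b c d) {e : ℕ × ℕ} (he : e = (1, 0) ∨ e = (0, 1))
    {ρ : ℝ} (hρ : 0 < ρ)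
    (hρm : ρ < 1 / eigm a c) (n : ℕ) :
    ∃ C, 0 < C ∧ ∀ t, 0 < t →
      absCharFun a b c d ((n + 1) • e) t ≤ C * t ^ (-((n + 1) * ρ)) := by
  have he0 : e ≠ 0 := by rcases he with rfl | rfl <;> simp
  have h1 : (e.1 : ℝ) + e.2 = 1 := by rcases he with rfl | rfl <;> simp
  have hS' := H.cast_pos
  have hρ' : 0 < 1 - ρ * eigm a c := by
    rw [lt_div_iff₀ H.eigm_pos] at hρm
    linarith
  obtain ⟨C, hC, hCe⟩ := H.exists_rpow_bound_ball he hρ hρm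
  induction n with
  | zero => exact ⟨C, hC, by simpa using hCe⟩
  | succ n ih =>
    obtain ⟨D, hD, hDn⟩ := ih
    have hn0 : (n + 1) • e ≠ 0 := by rcases he with rfl | rfl <;> simp
    have h2 : (((n + 1) • e).1 : ℝ) + ((n + 1) • e).2 = n + 1 := by
      simp only [Prod.smul_fst, Prod.smul_snd, smul_eq_mul]
      push_cast
      rw [← mul_add, h1, mul_one]
    have key (k : ℝ) (hk : 0 < k) : 0 < k / (a + b : ℝ) - sigma a b c * (k * ρ) := by
      have : k / (a + b : ℝ) - sigma a b c * (k * ρ) = k * (1 - ρ * eigm a c) / (a + b) := by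
        rw [H.eigm_eq]; field_simp
      rw [this]
      positivity
    obtain ⟨E, hE, hEn⟩ := rpow_bound_of_mixture_le (σ := sigma a b c) (p := (n + 1) * ρ) (q := ρ)
      (H.shape_pos hn0) (H.shape_pos he0) (by rw [h2]; exact key _ (by positivity))
      (by rw [h1]; simpa using key 1 one_pos) hD hC
      (fun t ht => ⟨(H.absCharFun_mem _ t).1, hDn t ht⟩)
      (fun t ht => ⟨(H.absCharFun_mem _ t).1, hCe t ht⟩)
      (H.continuous_absCharFun _).measurable (H.continuous_absCharFun e).measurable
      (fun t _ => H.absCharFun_add_le hn0 he0 t)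
    refine ⟨E, hE, fun t ht => ?_⟩
    have := hEn t ht
    rw [← succ_nsmul] at this
    convert this using 4
    push_cast
    ring

/-- Decay of the characteristic function of the limit law started from a single ball. -/
theorem exists_bound_charFun (H : IsLarge a b c d) {e r : ℕ × ℕ} (he : e = (1, 0) ∨ e = (0, 1))
    (hr : r ≠ 0) {n : ℕ}
    (hlaw : law a b c d e = law a b c d ((n + 1) • e + r)) {ρ : ℝ} (hρ : 0 < ρ)
    (hρm : ρ < ((n : ℝ) + 1) / eigm a c) :
    ∃ C, 0 < C ∧ ∀ t : ℝ, t ≠ 0 → ‖charFun (law a b c d e) t‖ ≤ C / |t| ^ ρ := by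
  have hn : (0 : ℝ) < n + 1 := by positivity
  have hS' := H.cast_pos
  have h1 : (e.1 : ℝ) + e.2 = 1 := by rcases he with rfl | rfl <;> simp
  have hn0 : (n + 1) • e ≠ 0 := by rcases he with rfl | rfl <;> simp
  -- The rate is shared equally among the `n + 1` balls of the same colour.
  have hρ1 : 0 < ρ / (n + 1) := by positivity
  have hρ2 : ρ / (n + 1) < 1 / eigm a c := by
    rw [div_lt_div_iff₀ hn H.eigm_pos]
    rw [lt_div_iff₀ H.eigm_pos] at hρm
    linarith
  obtain ⟨D, hD, hDn⟩ := H.exists_rpow_bound_nsmul he hρ1 hρ2 n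
  have h2 : (((n + 1) • e).1 : ℝ) + ((n + 1) • e).2 = n + 1 := by
    simp only [Prod.smul_fst, Prod.smul_snd, smul_eq_mul]
    push_cast
    rw [← mul_add, h1, mul_one]
  have hcancel : ((n : ℝ) + 1) * (ρ / (n + 1)) = ρ := by field_simp
  rw [hcancel] at hDn
  have hpos : 0 < ((n : ℝ) + 1) / (a + b) - sigma a b c * ρ := by
    rw [sub_pos, lt_div_iff₀ hS']
    rw [lt_div_iff₀ H.eigm_pos, H.eigm_eq] at hρm
    linarith
  -- The remaining balls `r` contribute only the trivial bound one.
  obtain ⟨E, hE, hEn⟩ := rpow_bound_of_mixture_le (σ := sigma a b c) (p := ρ) (q := 0)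
    (H.shape_pos hn0) (H.shape_pos hr) (by rw [h2]; exact hpos)
    (by simpa using H.shape_pos hr) hD one_pos
    (fun t ht => ⟨(H.absCharFun_mem _ t).1, hDn t ht⟩)
    (fun t ht => ⟨(H.absCharFun_mem _ t).1, by simpa using (H.absCharFun_mem r t).2⟩)
    (H.continuous_absCharFun _).measurable (H.continuous_absCharFun r).measurable
    (fun t _ => H.absCharFun_add_le hn0 hr t)
  refine ⟨E, hE, fun t ht => ?_⟩
  have h3 := hEn |t| (abs_pos.2 ht)
  rw [add_zero, Real.rpow_neg (abs_nonneg t), ← div_eq_mul_inv] at h3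
  rw [hlaw]
  rcases abs_choice t with h | h
  · rw [h] at h3 ⊢
    exact h3
  · rw [h] at h3 ⊢
    rwa [absCharFun, charFun_neg, RCLike.norm_conj] at h3

end IsLarge

end Urn

/-! ### Fourier inversion for laws with integrable characteristic function -/

section Inversion

open scoped FourierTransform SchwartzMap ContDiff

variable {μ : Measure ℝ}

/-- Candidate density: the Fourier transform of the rescaled characteristic function. -/
noncomputable def fourierDensity (μ : Measure ℝ) : ℝ → ℂ :=
  𝓕 fun v : ℝ => charFun μ (2 * Real.pi * v)

/-- Fourier inversion of `g` followed by Fubini; the `2π` comes from the normalisation of `𝓕`. -/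
lemma integral_schwartz_eq_integral_charFun [IsProbabilityMeasure μ] (g : 𝓢(ℝ, ℂ)) :
    ∫ x, g x ∂μ = ∫ v, 𝓕 (g : ℝ → ℂ) v * charFun μ (2 * Real.pi * v) := by
  have hgF : Integrable (𝓕 (g : ℝ → ℂ)) := by
    rw [← SchwartzMap.fourier_coe]; exact (𝓕 g).integrable
  have hinv (x : ℝ) : g x =
      ∫ v, Complex.exp ((2 * Real.pi * v : ℝ) * x * Complex.I) * 𝓕 (g : ℝ → ℂ) v := by
    have h := congrFun (g.continuous.fourierInv_fourier_eq g.integrable hgF) x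
    rw [← h, Real.fourierInv_eq']
    refine integral_congr_ae (ae_of_all _ fun v => ?_)
    simp only [smul_eq_mul, RCLike.inner_apply, conj_trivial]
    congr 2
    simp
    ring
  simp only [hinv]
  rw [integral_integral_swap]
  · refine integral_congr_ae (ae_of_all _ fun v => ?_)
    simp only
    rw [integral_mul_const, ← charFun_apply_real, mul_comm]
  · have h1 : Integrable (fun p : ℝ × ℝ => 𝓕 (g : ℝ → ℂ) p.2) (μ.prod volume) :=
      hgF.comp_snd μ
    refine h1.norm.mono' ?_ (ae_of_all _ fun p => ?_)
    · refine AEStronglyMeasurable.mul ?_ h1.aestronglyMeasurable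
      exact Measurable.aestronglyMeasurable (by fun_prop)
    · simp only [Function.uncurry]
      rw [norm_mul, ← Complex.ofReal_mul, Complex.norm_exp_ofReal_mul_I, one_mul]

lemma integrable_charFun_scaled (hμ : Integrable (charFun μ)) : Integrable fun v : ℝ => charFun μ
    (2 * Real.pi * v) :=
  hμ.comp_mul_left' (by positivity)

lemma integral_schwartz_eq_integral_fourierDensity [IsProbabilityMeasure μ]
    (hμ : Integrable (charFun μ)) (g : 𝓢(ℝ, ℂ)) :
    ∫ x, g x ∂μ = ∫ x, g x * fourierDensity μ x := by
  rw [integral_schwartz_eq_integral_charFun]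
  have h := VectorFourier.integral_fourierIntegral_smul_eq_flip (L := innerₗ ℝ)
    Real.continuous_fourierChar continuous_inner (g.integrable (μ := volume))
    (integrable_charFun_scaled hμ)
  rw [flip_innerₗ] at h
  exact h

lemma continuous_fourierDensity (hμ : Integrable (charFun μ)) : Continuous (fourierDensity μ) :=
  VectorFourier.fourierIntegral_continuous Real.continuous_fourierChar
    (L := innerₗ ℝ) continuous_inner (integrable_charFun_scaled hμ)

/-- Reality of the density comes from `φ(-t) = conj φ(t)` and the substitution `v ↦ -v`. -/
lemma conj_fourierDensity (x : ℝ) : (starRingEnd ℂ) (fourierDensity μ x) = fourierDensity μ x := by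
  unfold fourierDensity
  rw [Real.fourier_real_eq_integral_exp_smul, ← integral_conj, ← integral_neg_eq_self]
  refine integral_congr_ae (ae_of_all _ fun v => ?_)
  simp only [smul_eq_mul, map_mul]
  rw [mul_neg (2 * Real.pi) v, charFun_neg, Complex.conj_conj, ← Complex.exp_conj, map_mul,
    Complex.conj_ofReal, Complex.conj_I]
  congr 2
  push_cast
  ring

lemma ofReal_re_fourierDensity (x : ℝ) :
    (((fourierDensity μ x).re : ℝ) : ℂ) = fourierDensity μ x :=
  Complex.conj_eq_iff_re.1 (conj_fourierDensity x)

lemma integral_smooth_eq_integral_fourierDensity [IsProbabilityMeasure μ]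
    (hμ : Integrable (charFun μ)) {g : ℝ → ℝ} (hg : ContDiff ℝ ∞ g)
    (hgc : HasCompactSupport g) :
    ∫ x, g x ∂μ = ∫ x, g x * (fourierDensity μ x).re := by
  have hc : HasCompactSupport fun x => (g x : ℂ) := hgc.comp_left (g := fun y : ℝ => (y : ℂ))
      (by simp)
  have hs : ContDiff ℝ ∞ fun x => (g x : ℂ) := Complex.ofRealCLM.contDiff.comp hg
  have h := integral_schwartz_eq_integral_fourierDensity hμ (hc.toSchwartzMap hs)
  simp only [HasCompactSupport.toSchwartzMap_toFun] at h
  have h2 : ∀ x, (g x : ℂ) * fourierDensity μ x =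
      ((g x * (fourierDensity μ x).re : ℝ) : ℂ) := fun x => by
    rw [Complex.ofReal_mul, ofReal_re_fourierDensity]
  have h' : ∫ x, (g x : ℂ) ∂μ = ∫ x, (g x : ℂ) * fourierDensity μ x := h
  simp only [h2] at h'
  rw [integral_complex_ofReal, integral_complex_ofReal] at h'
  exact_mod_cast h'

/-- A bump function supported where the continuous candidate is negative would have negative
integral against `μ`. -/
lemma re_fourierDensity_nonneg [IsProbabilityMeasure μ] (hμ : Integrable (charFun μ)) (x : ℝ) : 0
    ≤ (fourierDensity μ x).re := by
  by_contra! hneg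
  have hcont : Continuous fun x => (fourierDensity μ x).re :=
    Complex.continuous_re.comp (continuous_fourierDensity hμ)
  obtain ⟨δ, hδ, hball⟩ := Metric.isOpen_iff.1 (isOpen_lt hcont continuous_const) x hneg
  let f : ContDiffBump x := ⟨δ / 3, δ / 2, by positivity, by linarith⟩
  have h1 := integral_smooth_eq_integral_fourierDensity hμ f.contDiff f.hasCompactSupport
  have h2 : 0 ≤ ∫ y, f y ∂μ := integral_nonneg fun y => f.nonneg
  have h3 : 0 < ∫ y, -(f y * (fourierDensity μ y).re) := by
    refine Continuous.integral_pos_of_hasCompactSupport_nonneg_nonzero (x := x) ?_ ?_ ?_ ?_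
    · exact (f.continuous.mul hcont).neg
    · exact (f.hasCompactSupport.mul_right).neg
    · intro y
      simp only [Pi.zero_apply, Left.nonneg_neg_iff]
      by_cases hy : y ∈ Metric.ball x δ
      · exact mul_nonpos_of_nonneg_of_nonpos f.nonneg (le_of_lt (hball hy))
      · rw [f.zero_of_le_dist, zero_mul]
        have : δ ≤ dist y x := by simpa using hy
        change δ / 2 ≤ dist y x
        linarith
    · have : f x = 1 := f.one_of_mem_closedBall (Metric.mem_closedBall_self (by positivity))
      rw [this, one_mul]
      exact (neg_pos.2 hneg).ne'
  rw [integral_neg] at h3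
  linarith

/-- Bump functions equal to one on growing balls bound the integrals there by the total mass of `μ`.
-/
lemma integrable_re_fourierDensity [IsProbabilityMeasure μ] (hμ : Integrable (charFun μ)) :
    Integrable fun x => (fourierDensity μ x).re := by
  have hcont : Continuous fun x => (fourierDensity μ x).re :=
    Complex.continuous_re.comp (continuous_fourierDensity hμ)
  have hcover : AECover (volume : Measure ℝ) atTop
      fun n : ℕ => Metric.closedBall (0 : ℝ) ((n : ℝ) + 1) :=
    aecover_closedBall (tendsto_atTop_add_const_right _ _ tendsto_natCast_atTop_atTop)
  refine hcover.integrable_of_integral_bounded_of_nonneg_ae 1 (fun n => ?_)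
    (ae_of_all _ (re_fourierDensity_nonneg hμ)) (Eventually.of_forall fun n => ?_)
  · exact hcont.continuousOn.integrableOn_compact (isCompact_closedBall _ _)
  let f : ContDiffBump (0 : ℝ) := ⟨n + 1, n + 2, by positivity, by linarith⟩
  have h1 := integral_smooth_eq_integral_fourierDensity hμ f.contDiff f.hasCompactSupport
  have h2 : ∫ y, f y ∂μ ≤ 1 := by
    refine (integral_mono ?_ (integrable_const 1) fun y => f.le_one).trans_eq (by simp)
    exact Integrable.of_bound (C := 1) f.continuous.aestronglyMeasurable
      (ae_of_all _ fun y => by rw [Real.norm_of_nonneg f.nonneg]; exact f.le_one)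
  rw [← integral_indicator Metric.isClosed_closedBall.measurableSet]
  refine le_trans ?_ (h1.symm.trans_le h2)
  refine integral_mono ?_ ?_ fun y => ?_
  · exact (hcont.continuousOn.integrableOn_compact (isCompact_closedBall _ _)).integrable_indicator
      Metric.isClosed_closedBall.measurableSet
  · exact (f.continuous.mul hcont).integrable_of_hasCompactSupport f.hasCompactSupport.mul_right
  · simp only
    by_cases hy : y ∈ Metric.closedBall (0 : ℝ) ((n : ℝ) + 1)
    · rw [Set.indicator_of_mem hy, f.one_of_mem_closedBall hy, one_mul]
    · rw [Set.indicator_of_notMem hy]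
      exact mul_nonneg f.nonneg (re_fourierDensity_nonneg hμ y)

/-- A law on `ℝ` with integrable characteristic function has a bounded continuous density. -/
theorem hasBoundedContinuousDensity_of_integrable_charFun [IsProbabilityMeasure μ]
    (hμ : Integrable (charFun μ)) : HasBoundedContinuousDensity μ := by
  have hcont : Continuous fun x => (fourierDensity μ x).re :=
    Complex.continuous_re.comp (continuous_fourierDensity hμ)
  have hnn := re_fourierDensity_nonneg hμ
  have hint := integrable_re_fourierDensity hμ
  -- Once the candidate density is integrable, a second Fourier inversion identifies the
  -- characteristic functions.
  have heq : μ = volume.withDensity (fun x => ENNReal.ofReal (fourierDensity μ x).re) := by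
    have := isFiniteMeasure_withDensity_ofReal hint.2
    refine Measure.ext_of_charFun (funext fun t => ?_)
    have hφ : Continuous fun v : ℝ => charFun μ (2 * Real.pi * v) :=
      (continuous_charFun (μ := μ)).comp (by fun_prop)
    have hF : Integrable (fourierDensity μ) := by
      refine hint.ofReal.congr (ae_of_all _ fun x => ?_)
      exact ofReal_re_fourierDensity x
    have h := congrFun (hφ.fourierInv_fourier_eq (integrable_charFun_scaled hμ) hF)
      (t / (2 * Real.pi))
    rw [mul_div_cancel₀ _ (by positivity : 2 * Real.pi ≠ 0)] at h
    rw
        [← h, charFun_apply_real, integral_withDensity_eq_integral_toReal_smul hcont.measurable.ennreal_ofReal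
      (ae_of_all _ fun _ => ENNReal.ofReal_lt_top), Real.fourierInv_eq']
    refine integral_congr_ae (ae_of_all _ fun x => ?_)
    simp only [smul_eq_mul, Complex.real_smul]
    rw [ENNReal.toReal_ofReal (hnn x), ofReal_re_fourierDensity, mul_comm]
    change fourierDensity μ x * _ = fourierDensity μ x * _
    congr 2
    have : inner ℝ x (t / (2 * Real.pi)) = t / (2 * Real.pi) * x := by simp
    rw [this, show 2 * Real.pi * (t / (2 * Real.pi) * x) = t * x by field_simp]
    push_cast
    ring
  refine ⟨?_, _, hcont, hnn, ⟨∫ v, ‖charFun μ (2 * Real.pi * v)‖, fun x => ?_⟩, heq⟩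
  · rw [heq]; exact withDensity_absolutelyContinuous _ _
  · exact (Complex.re_le_norm _).trans
      (VectorFourier.norm_fourierIntegral_le_integral_norm _ _ _ _ _)

end Inversion

/-- Near zero the trivial bound one is used; for `|t| ≥ 1`, the factor `2 ^ ρ` pays for `1 + |t| ≤
2|t|`. -/
lemma integrable_charFun_of_bound {μ : Measure ℝ} [IsProbabilityMeasure μ] {C ρ : ℝ} (hρ : 1 < ρ)
    (h : ∀ t : ℝ, t ≠ 0 → ‖charFun μ t‖ ≤ C / |t| ^ ρ) : Integrable (charFun μ) := by
  have hdecay : Integrable fun t : ℝ => max 1 C * 2 ^ ρ * (1 + ‖t‖) ^ (-ρ) :=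
    (integrable_one_add_norm (by simpa using hρ)).const_mul _
  refine hdecay.mono' measurable_charFun.aestronglyMeasurable (ae_of_all _ fun t => ?_)
  have h1 : 0 < 1 + ‖t‖ := by positivity
  rw [Real.rpow_neg h1.le, ← div_eq_mul_inv, le_div_iff₀ (Real.rpow_pos_of_pos h1 ρ)]
  have hm : 0 ≤ max 1 C := zero_le_one.trans (le_max_left _ _)
  rcases le_total ‖t‖ 1 with ht | ht
  · refine mul_le_mul ((norm_charFun_le_one t).trans (le_max_left _ _)) ?_ (by positivity) hm
    exact Real.rpow_le_rpow h1.le (by linarith) (by linarith)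
  · have ht0 : t ≠ 0 := by
      rintro rfl
      norm_num at ht
    have ht1 : 0 < |t| := abs_pos.2 ht0
    have h2 := h t ht0
    rw [le_div_iff₀ (Real.rpow_pos_of_pos ht1 ρ)] at h2
    calc ‖charFun μ t‖ * (1 + ‖t‖) ^ ρ ≤ ‖charFun μ t‖ * (2 * |t|) ^ ρ := by
          refine mul_le_mul_of_nonneg_left ?_ (norm_nonneg _)
          exact Real.rpow_le_rpow h1.le (by rw [Real.norm_eq_abs] at ht ⊢; linarith) (by linarith)
      _ = ‖charFun μ t‖ * |t| ^ ρ * 2 ^ ρ := by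
          rw [Real.mul_rpow zero_le_two ht1.le]; ring
      _ ≤ _ := mul_le_mul_of_nonneg_right (h2.trans (le_max_right _ _)) (by positivity)

/-! ### Decay rates and densities of the one-ball laws -/

namespace IsLarge

variable {a b c d : ℕ}

/-- After the forced draw, `(a + 1, b)` splits into `a + 1` red balls and a remainder `(0, b)`,
nonempty since `b ≠ 0`. -/
lemma exists_bound_charFun_red (H : IsLarge a b c d) {ρ : ℝ} (hρ : 0 < ρ)
    (hρm : ρ < ((a : ℝ) + 1) / eigm a c) :
    ∃ C, 0 < C ∧ ∀ t : ℝ, t ≠ 0 → ‖charFun (law a b c d (1, 0)) t‖ ≤ C / |t| ^ ρ := by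
  refine H.exists_bound_charFun (Or.inl rfl) (r := (0, b)) (by simp [H.b_ne_zero]) ?_ hρ hρm
  rw [H.law_red]
  simp

lemma exists_bound_charFun_black (H : IsLarge a b c d) {ρ : ℝ} (hρ : 0 < ρ)
    (hρm : ρ < ((d : ℝ) + 1) / eigm a c) :
    ∃ C, 0 < C ∧ ∀ t : ℝ, t ≠ 0 → ‖charFun (law a b c d (0, 1)) t‖ ≤ C / |t| ^ ρ := by
  refine H.exists_bound_charFun (Or.inr rfl) (r := (c, 0)) (by simp [H.c_ne_zero]) ?_ hρ hρm
  rw [H.law_black]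
  simp

/-- Since `a + 1 > a - c = m`, a rate `ρ > 1` is available. -/
lemma hasBoundedContinuousDensity_red (H : IsLarge a b c d) : HasBoundedContinuousDensity
    (law a b c d (1, 0)) := by
  have := H.isProbabilityMeasure_law (1, 0)
  have h : (1 : ℝ) < ((a : ℝ) + 1) / eigm a c := by
    rw [lt_div_iff₀ H.eigm_pos, eigm]
    have : (0 : ℝ) ≤ c := by positivity
    linarith
  obtain ⟨ρ, hρ1, hρ2⟩ := exists_between h
  obtain ⟨C, -, hC⟩ := H.exists_bound_charFun_red (by linarith) hρ2
  exact hasBoundedContinuousDensity_of_integrable_charFun (integrable_charFun_of_bound hρ1 hC)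

lemma hasBoundedContinuousDensity_black (H : IsLarge a b c d) : HasBoundedContinuousDensity
    (law a b c d (0, 1)) := by
  have := H.isProbabilityMeasure_law (0, 1)
  have h : (1 : ℝ) < ((d : ℝ) + 1) / eigm a c := by
    rw [lt_div_iff₀ H.eigm_pos, eigm]
    have : (0 : ℝ) ≤ b := by positivity
    have : (a : ℝ) + b = c + d := by exact_mod_cast H.balance
    linarith
  obtain ⟨ρ, hρ1, hρ2⟩ := exists_between h
  obtain ⟨C, -, hC⟩ := H.exists_bound_charFun_black (by linarith) hρ2
  exact hasBoundedContinuousDensity_of_integrable_charFun (integrable_charFun_of_bound hρ1 hC)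

end IsLarge

end PolyaUrn

theorem mainTheorem5 (a b c d : ℕ)
    (hbalance : a + b = c + d)
    (hb : b ≠ 0) (hc : c ≠ 0)
    (hlarge : 1 / 2 < PolyaUrn.sigma a b c)
    {Ω : Type*} [MeasurableSpace Ω] (P : Measure Ω) [IsProbabilityMeasure P]
    (U : ℕ → Ω → ℕ × ℕ) (hU : PolyaUrn.IsUrnProcess a b c d (1, 0) P U)
    {Ω' : Type*} [MeasurableSpace Ω'] (P' : Measure Ω') [IsProbabilityMeasure P']
    (U' : ℕ → Ω' → ℕ × ℕ) (hU' : PolyaUrn.IsUrnProcess a b c d (0, 1) P' U') :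
    -- the almost sure limits `X` and `Y` exist
    (∀ᵐ ω ∂P, Tendsto (fun n : ℕ => PolyaUrn.normProj a b c U n ω) atTop
      (𝓝 (PolyaUrn.W a b c U ω))) ∧
    (∀ᵐ ω ∂P', Tendsto (fun n : ℕ => PolyaUrn.normProj a b c U' n ω) atTop
      (𝓝 (PolyaUrn.W a b c U' ω))) ∧
    -- (i) supports
    (P.map (PolyaUrn.W a b c U)).support = Set.univ ∧
    (P'.map (PolyaUrn.W a b c U')).support = Set.univ ∧
    -- (ii) decay of the characteristic function of `X`
    (∀ ρ : ℝ, 0 < ρ → ρ < ((a : ℝ) + 1) / PolyaUrn.eigm a c →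
      ∃ C : ℝ, 0 < C ∧ ∀ t : ℝ, t ≠ 0 →
        ‖charFun (P.map (PolyaUrn.W a b c U)) t‖ ≤ C / |t| ^ ρ) ∧
    -- (iii) decay of the characteristic function of `Y`
    (∀ ρ : ℝ, 0 < ρ → ρ < ((d : ℝ) + 1) / PolyaUrn.eigm a c →
      ∃ C : ℝ, 0 < C ∧ ∀ t : ℝ, t ≠ 0 →
        ‖charFun (P'.map (PolyaUrn.W a b c U')) t‖ ≤ C / |t| ^ ρ) ∧
    -- (iv) densities
    PolyaUrn.HasBoundedContinuousDensity (P.map (PolyaUrn.W a b c U)) ∧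
    PolyaUrn.HasBoundedContinuousDensity (P'.map (PolyaUrn.W a b c U')) := by
  have H : PolyaUrn.IsLarge a b c d := ⟨hbalance, hb, hc, hlarge⟩
  have h1 := hU.exists_limit hbalance H.total_pos hlarge (by simp)
  have h2 := hU'.exists_limit hbalance H.total_pos hlarge (by simp)
  -- The given processes enter only through their limit laws, which are the canonical ones.
  rw [hU.map_W_eq_law H (by simp), hU'.map_W_eq_law H (by simp)]
  exact ⟨h1.1, h2.1, H.support_law_red, H.support_law_black,
    fun _ hρ hρm => H.exists_bound_charFun_red hρ hρm,
    fun _ hρ hρm => H.exists_bound_charFun_black hρ hρm,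
    H.hasBoundedContinuousDensity_red, H.hasBoundedContinuousDensity_black⟩
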